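/- **Conventions.** For $x,y$ in a group, $[x,y]=x^{-1}y^{-1}xy$. A pair $(H,K)$ of subgroups of a finite group $G$ is a *Shoda pair* of $G$ if (i) $K\trianglelefteq H$ and $H/K$ is cyclic, and (ii) if $g\in G$ and $\{[h,g] : h\in H\}\cap H\subseteq K$, then $g\in H$. For an irreducible complex character $\chi$ of a finite group $X$, with field of values $\mathbb{Q}(\chi)$, $$e_{\mathbb{Q}}(\chi)=\frac{\chi(1)}{|X|}\sum_{\sigma\in \operatorname{Gal}(\mathbb{Q}(\chi)/\mathbb{Q})}\ \sum_{g\in X}\sigma(\chi(g))\,g^{-1},$$ which is a central idempotent of $\mathbb{Q}X$. For $e\in\mathbb{Q}G$, $\operatorname{Cen}_G(e)=\{g\in G : ge=eg\}$. For a ring $R$, a group $\Gamma$, and maps $\sigma:\Gamma\to\operatorname{Aut}(R)$ and $\tau:\Gamma\times\Gamma\to\mathcal{U}(R)$ with $\sigma_p(\sigma_q(r))\,\tau(p,q)=\tau(p,q)\,\sigma_{pq}(r)$ and $\tau(p,q)\tau(pq,t)=\sigma_p(\tau(q,t))\tau(p,qt)$, the *crossed product* $R*^{\sigma}_{\tau}\Gamma$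 is the free left $R$-module on symbols $u_q$ ($q\in\Gamma$), with the associative multiplication given by $(r u_p)(s u_q)=r\,\sigma_p(s)\,\tau(p,q)\,u_{pq}$. **Statement.** Let $G$ be a finite group, $(H,K)$ a Shoda pair of $G$, and $\psi$ a linear complex character of $H$ with kernel $K$. Suppose that $A$ is a normal subgroup of $G$ and $L$ a subgroup of $G$ such that $A\le H\le L$, the restriction $\psi_A$ is invariant in $L$ (that is, $\psi(xax^{-1})=\psi(a)$ for all $x\in L$, $a\in A$), and $L\trianglelefteq N_G(\ker\psi_A)$. Let $\psi^L$ and $\psi^G$ be the characters induced by $\psi$, let $C=\operatorname{Cen}_G(e_{\mathbb{Q}}(\psi^L))$ and $n=[G:C]$. Then $e_{\mathbb{Q}}(\psi^G)$ and $e_{\mathbb{Q}}(\psi^L)$ are central idempotents of $\mathbb{Q}G$ and $\mathbb{Q}L$ respectively, $L\trianglelefteq C$, and, for every choice of representatives $\overline{x}\in C$ of the cosets $x\in C/L$, there is an isomorphism of rings $$\mathbb{Q}G\,e_{\mathbb{Q}}(\psi^{G})\;\cong\; M_{n}\bigl(\mathbb{Q}L\,e_{\mathbb{Q}}(\psi^{L})*^{\sigma}_{\tau}C/L\bigr),$$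 where $\sigma_x$ is the automorphism $r\mapsto \overline{x}\,r\,\overline{x}^{-1}$ of $\mathbb{Q}L\,e_{\mathbb{Q}}(\psi^L)$, and $\tau(x,y)=g\,e_{\mathbb{Q}}(\psi^L)$ for the element $g\in L$ with $\overline{x}\cdot\overline{y}=g\cdot\overline{xy}$. -/

import Mathlib

open scoped MonoidAlgebra

noncomputable section

/-! Crossed products -/

/-- An action `σ` and a twisting `τ` of a group `Γ` over a ring `R`, subject to the conditions
that make the crossed product associative. The map `σ` need not be a homomorphism, and neither
`σ` nor `τ` is assumed to be normalized. -/
structure CrossedSystem (R Γ : Type*) [Ring R] [Group Γ] where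
  σ : Γ → R ≃+* R
  τ : Γ → Γ → Rˣ
  comp : ∀ g h r, σ g (σ h r) * τ g h = τ g h * σ (g * h) r
  cocycle : ∀ g h k, (τ g h : R) * τ (g * h) k = σ g (τ h k) * τ g (h * k)

/-- The crossed product of `Γ` over `R` with action `σ` and twisting `τ`: the free left
`R`-module on symbols `u g`, `g ∈ Γ`. The element `∑ r_g u g` is the finitely supported
function `g ↦ r_g`. -/
structure CrossedProduct {R Γ : Type*} [Ring R] [Group Γ] (S : CrossedSystem R Γ) where
  coeff : Γ →₀ R

namespace CrossedProduct

variable {R Γ : Type*} [Ring R] [Group Γ] {S : CrossedSystem R Γ}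

@[ext]
theorem ext {x y : CrossedProduct S} (h : x.coeff = y.coeff) : x = y := by
  cases x; cases y; cases h; rfl

instance : AddCommGroup (CrossedProduct S) :=
  let e : CrossedProduct S ≃ (Γ →₀ R) := ⟨coeff, mk, fun _ => rfl, fun _ => rfl⟩
  e.addCommGroup

theorem coeff_add (x y : CrossedProduct S) : (x + y).coeff = x.coeff + y.coeff := rfl

theorem coeff_zero : (0 : CrossedProduct S).coeff = 0 := rfl

/-- The element `r u g`. -/
def single (S : CrossedSystem R Γ) (g : Γ) (r : R) : CrossedProduct S := ⟨Finsupp.single g r⟩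

/-- The unique biadditive product with `(r u a) (s u b) = r σ_a(s) τ(a, b) u (a b)`; that is,
`u a * u b = τ(a, b) u (a b)` and `u a * s = σ_a(s) u a`. -/
instance : Mul (CrossedProduct S) where
  mul x y := ⟨x.coeff.sum fun a r => y.coeff.sum fun b s =>
    Finsupp.single (a * b) (r * S.σ a s * S.τ a b)⟩

/-- The identity element `τ(1, 1)⁻¹ u 1`. -/
instance : One (CrossedProduct S) where
  one := single S 1 ((S.τ 1 1)⁻¹ : Rˣ)

theorem coeff_mul (x y : CrossedProduct S) :
    (x * y).coeff = x.coeff.sum fun a r => y.coeff.sum fun b s =>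
      Finsupp.single (a * b) (r * S.σ a s * S.τ a b) := rfl

theorem one_def : (1 : CrossedProduct S) = single S 1 ((S.τ 1 1)⁻¹ : Rˣ) := rfl

theorem single_mul_single (a b : Γ) (r s : R) :
    single S a r * single S b s = single S (a * b) (r * S.σ a s * S.τ a b) := by
  ext1
  rw [coeff_mul]
  simp [single]

theorem add_mul' (x y z : CrossedProduct S) : (x + y) * z = x * z + y * z := by
  ext1
  rw [coeff_add, coeff_mul, coeff_add, Finsupp.sum_add_index']
  · rfl
  · simp
  · intro a r s
    rw [← Finsupp.sum_add]
    simp [add_mul]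

theorem mul_add' (x y z : CrossedProduct S) : x * (y + z) = x * y + x * z := by
  ext1
  rw [coeff_add, coeff_mul, coeff_add, coeff_mul, coeff_mul, ← Finsupp.sum_add]
  refine Finsupp.sum_congr fun a _ => ?_
  rw [Finsupp.sum_add_index']
  · simp
  · intro b r s
    simp [mul_add, add_mul]

theorem zero_mul' (x : CrossedProduct S) : 0 * x = 0 := by
  simpa using add_mul' 0 0 x

theorem mul_zero' (x : CrossedProduct S) : x * 0 = 0 := by
  simpa using mul_add' x 0 0

theorem induction_on {p : CrossedProduct S → Prop} (x : CrossedProduct S) (h0 : p 0)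
    (hs : ∀ g r, p (single S g r)) (ha : ∀ x y, p x → p y → p (x + y)) : p x := by
  obtain ⟨f⟩ := x
  induction f using Finsupp.induction_linear with
  | zero => exact h0
  | add f g hf hg => exact ha _ _ hf hg
  | single g r => exact hs g r

theorem mul_assoc' (x y z : CrossedProduct S) : x * y * z = x * (y * z) := by
  induction x using induction_on with
  | h0 => simp only [zero_mul']
  | ha x x' hx hx' => simp only [add_mul', hx, hx']
  | hs a r =>
    induction y using induction_on with
    | h0 => simp only [zero_mul', mul_zero']
    | ha y y' hy hy' => simp only [add_mul', mul_add', hy, hy']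
    | hs b s =>
      induction z using induction_on with
      | h0 => simp only [mul_zero']
      | ha z z' hz hz' => simp only [mul_add', hz, hz']
      | hs c t =>
        rw [single_mul_single, single_mul_single, single_mul_single, single_mul_single, mul_assoc]
        congr 1
        have h1 := S.comp a b t
        have h2 := S.cocycle a b c
        calc r * S.σ a s * S.τ a b * S.σ (a * b) t * S.τ (a * b) c
            = r * S.σ a s * (S.τ a b * S.σ (a * b) t) * S.τ (a * b) c := by simp only [mul_assoc]
          _ = r * S.σ a s * S.σ a (S.σ b t) * (S.τ a b * S.τ (a * b) c) := by
              rw [← h1]; simp only [mul_assoc]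
          _ = _ := by rw [h2]; simp only [map_mul, mul_assoc]

theorem σ_one (r : R) : S.σ 1 r * S.τ 1 1 = S.τ 1 1 * r := by
  obtain ⟨s, rfl⟩ := (S.σ 1).surjective r
  simpa using S.comp 1 1 s

theorem τ_one_left (g : Γ) : S.τ 1 g = S.τ 1 1 := by
  have h := S.cocycle 1 1 g
  rw [one_mul, one_mul] at h
  have h1 : (S.τ 1 1 : R) = S.σ 1 (S.τ 1 g) := (S.τ 1 g).isUnit.mul_right_cancel h
  have h2 := σ_one (S := S) (S.τ 1 g)
  rw [← h1] at h2
  exact (Units.ext ((S.τ 1 1).isUnit.mul_left_cancel h2)).symm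

theorem τ_one_right (g : Γ) : (S.τ g 1 : R) = S.σ g (S.τ 1 1) := by
  have h := S.cocycle g 1 1
  rw [mul_one, one_mul] at h
  exact (S.τ g 1).isUnit.mul_right_cancel h

theorem one_mul' (x : CrossedProduct S) : 1 * x = x := by
  induction x using induction_on with
  | h0 => simp only [mul_zero']
  | ha x y hx hy => simp only [mul_add', hx, hy]
  | hs g r =>
    rw [one_def, single_mul_single, τ_one_left g, mul_assoc, σ_one, one_mul,
      Units.inv_mul_cancel_left]

theorem mul_one' (x : CrossedProduct S) : x * 1 = x := by
  induction x using induction_on with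
  | h0 => simp only [zero_mul']
  | ha x y hx hy => simp only [add_mul', hx, hy]
  | hs g r =>
    rw [one_def, single_mul_single, τ_one_right, mul_assoc, ← map_mul, Units.inv_mul, map_one,
      mul_one, mul_one]

instance : Ring (CrossedProduct S) where
  __ := (inferInstance : AddCommGroup (CrossedProduct S))
  mul := (· * ·)
  one := 1
  left_distrib := mul_add'
  right_distrib := add_mul'
  zero_mul := zero_mul'
  mul_zero := mul_zero'
  mul_assoc := mul_assoc'
  one_mul := one_mul'
  mul_one := mul_one'

end CrossedProduct

/-! Cutting down by a central idempotent: for a central idempotent `e` of `R` the ring `R e`,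
with identity element `e`, is `IsIdempotentElem.Corner`, whose elements are the `e * r * e`. -/

section Corner

variable {R : Type*} [Ring R] {e : R}

/-- The projection `r ↦ r e` from `R` to `R e`, written `r ↦ e r e`. -/
def cornerProj (he : IsIdempotentElem e) (hc : IsMulCentral e) : R →+* he.Corner where
  toFun r := ⟨e * r * e, r, rfl⟩
  map_one' := Subtype.ext <| show e * 1 * e = e by rw [mul_one, he.eq]
  map_zero' := Subtype.ext <| show e * 0 * e = 0 by rw [mul_zero, zero_mul]
  map_add' r s := Subtype.ext <| show e * (r + s) * e = e * r * e + e * s * e by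
    rw [mul_add, add_mul]
  map_mul' r s := Subtype.ext <| show e * (r * s) * e = (e * r * e) * (e * s * e) by
    have h : r * e = e * r := ((hc.comm r).eq).symm
    calc e * (r * s) * e = (e * e) * (r * s) * e := by rw [he.eq]
      _ = e * (e * r) * s * e := by simp only [mul_assoc]
      _ = e * (r * (e * e)) * s * e := by rw [← h, he.eq]
      _ = _ := by simp only [mul_assoc]

theorem cornerProj_surjective (he : IsIdempotentElem e) (hc : IsMulCentral e) :
    Function.Surjective (cornerProj he hc) := by
  rintro ⟨_, r, rfl⟩
  exact ⟨r, rfl⟩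

/-- A ring automorphism of `R` that fixes `e` restricts to `R e`. -/
def cornerEquiv (he : IsIdempotentElem e) (φ : R ≃+* R) (h : φ e = e) :
    he.Corner ≃+* he.Corner where
  toFun x := ⟨φ x.1, by
    obtain ⟨_, r, rfl⟩ := x
    exact ⟨φ r, by simp [h]⟩⟩
  invFun x := ⟨φ.symm x.1, by
    obtain ⟨_, r, rfl⟩ := x
    have h' : φ.symm e = e := by rw [RingEquiv.symm_apply_eq, h]
    exact ⟨φ.symm r, by simp [h']⟩⟩
  left_inv x := Subtype.ext (φ.symm_apply_apply _)
  right_inv x := Subtype.ext (φ.apply_symm_apply _)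
  map_mul' x y := Subtype.ext (map_mul φ _ _)
  map_add' x y := Subtype.ext (map_add φ _ _)

theorem cornerEquiv_cornerProj (he : IsIdempotentElem e) (hc : IsMulCentral e) (φ : R ≃+* R)
    (h : φ e = e) (r : R) :
    cornerEquiv he φ h (cornerProj he hc r) = cornerProj he hc (φ r) :=
  Subtype.ext <| show φ (e * r * e) = e * φ r * e by simp [h]

/-- An action and a twisting over `R` whose action fixes the central idempotent `e` induce an
action and a twisting over `R e`: the automorphisms are restricted, and the unit `u` of `R` is
replaced by the unit `u e` of `R e`. -/
def CrossedSystem.corner {Γ : Type*} [Group Γ] (S : CrossedSystem R Γ)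
    (he : IsIdempotentElem e) (hc : IsMulCentral e) (hfix : ∀ g, S.σ g e = e) :
    CrossedSystem he.Corner Γ where
  σ g := cornerEquiv he (S.σ g) (hfix g)
  τ g h := Units.map (cornerProj he hc : R →* he.Corner) (S.τ g h)
  comp g h x := by
    obtain ⟨r, rfl⟩ := cornerProj_surjective he hc x
    simp only [cornerEquiv_cornerProj he hc, Units.coe_map, MonoidHom.coe_coe, ← map_mul, S.comp]
  cocycle g h k := by
    simp only [cornerEquiv_cornerProj he hc, Units.coe_map, MonoidHom.coe_coe, ← map_mul,
      S.cocycle]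

end Corner

/-! Subgroups, conjugation, and the crossed system of a group extension -/

section Groups

variable {G : Type*} [Group G]

/-- A Shoda pair `(H, K)` of `G`. In the last condition `[h, g] = h⁻¹ g⁻¹ h g`, and the condition
reads: if `[H, g] ∩ H ⊆ K`, where `[H, g] = {[h, g] : h ∈ H}`, then `g ∈ H`. -/
structure IsShodaPair (H K : Subgroup G) : Prop where
  le : K ≤ H
  normal : (K.subgroupOf H).Normal
  cyclic : IsCyclic (H ⧸ K.subgroupOf H)
  mem_of_commutator : ∀ g : G,
    (∀ h ∈ H, h⁻¹ * g⁻¹ * h * g ∈ H → h⁻¹ * g⁻¹ * h * g ∈ K) → g ∈ H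

/-- `Cen_G(e)` for an element `e` of `ℚ G`. -/
def centralizerOf (e : ℚ[G]) : Subgroup G where
  carrier := {g | MonoidAlgebra.of ℚ G g * e = e * MonoidAlgebra.of ℚ G g}
  one_mem' := by
    show MonoidAlgebra.of ℚ G 1 * e = e * MonoidAlgebra.of ℚ G 1
    rw [map_one, one_mul, mul_one]
  mul_mem' {a b} ha hb := by
    simp only [Set.mem_ofPred_eq, map_mul] at *
    rw [mul_assoc, hb, ← mul_assoc, ha, mul_assoc]
  inv_mem' {a} ha := by
    simp only [Set.mem_ofPred_eq] at *
    have h1 : MonoidAlgebra.of ℚ G a⁻¹ * MonoidAlgebra.of ℚ G a = 1 := by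
      rw [← map_mul, inv_mul_cancel, map_one]
    have h2 : MonoidAlgebra.of ℚ G a * MonoidAlgebra.of ℚ G a⁻¹ = 1 := by
      rw [← map_mul, mul_inv_cancel, map_one]
    calc MonoidAlgebra.of ℚ G a⁻¹ * e
        = MonoidAlgebra.of ℚ G a⁻¹ * e * (MonoidAlgebra.of ℚ G a * MonoidAlgebra.of ℚ G a⁻¹) := by
          rw [h2, mul_one]
      _ = MonoidAlgebra.of ℚ G a⁻¹ * (e * MonoidAlgebra.of ℚ G a) * MonoidAlgebra.of ℚ G a⁻¹ := by
          simp only [mul_assoc]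
      _ = (MonoidAlgebra.of ℚ G a⁻¹ * MonoidAlgebra.of ℚ G a) * e * MonoidAlgebra.of ℚ G a⁻¹ := by
          rw [← ha]; simp only [mul_assoc]
      _ = _ := by rw [h1, one_mul]

/-- The inclusion `ℚ L ⊆ ℚ G` for a subgroup `L` of `G`. -/
abbrev groupAlgebraIncl (L : Subgroup G) : ℚ[L] →+* ℚ[G] :=
  MonoidAlgebra.mapDomainRingHom ℚ L.subtype

/-- `Cen_G(e)` for an element `e` of `ℚ L`, where `L` is a subgroup of `G`. -/
abbrev cen (L : Subgroup G) (e : ℚ[L]) : Subgroup G := centralizerOf (groupAlgebraIncl L e)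

theorem le_cen {L : Subgroup G} {e : ℚ[L]} (hc : IsMulCentral e) : L ≤ cen L e := by
  intro l hl
  have h := congrArg (groupAlgebraIncl L) (hc.comm (MonoidAlgebra.of ℚ L ⟨l, hl⟩)).eq
  simp only [map_mul] at h
  have h' : groupAlgebraIncl L (MonoidAlgebra.of ℚ L ⟨l, hl⟩) = MonoidAlgebra.of ℚ G l := by
    simp [MonoidAlgebra.of_apply]
  rw [h'] at h
  exact h.symm

/-- Conjugation `l ↦ c l c⁻¹` on `L`, where `L ⊴ C ≤ G` and `c ∈ C`. -/
def conjEquiv {C L : Subgroup G} (hLC : L ≤ C) [(L.subgroupOf C).Normal] (c : C) : L ≃* L :=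
  (Subgroup.subgroupOfEquivOfLe hLC).symm.trans
    ((MulAut.conjNormal c).trans (Subgroup.subgroupOfEquivOfLe hLC))

theorem coe_conjEquiv {C L : Subgroup G} (hLC : L ≤ C) [(L.subgroupOf C).Normal] (c : C) (l : L) :
    (conjEquiv hLC c l : G) = c * l * (c : G)⁻¹ := rfl

/-- The automorphism of `ℚ L` induced by conjugation by `c`. -/
def conjAlg {C L : Subgroup G} (hLC : L ≤ C) [(L.subgroupOf C).Normal] (c : C) : ℚ[L] ≃+* ℚ[L] :=
  MonoidAlgebra.mapDomainRingEquiv ℚ (conjEquiv hLC c)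

/-- Inside `ℚ G`, the automorphism `conjAlg` is conjugation by `c`. -/
theorem incl_conjAlg_mul {C L : Subgroup G} (hLC : L ≤ C) [(L.subgroupOf C).Normal] (c : C)
    (x : ℚ[L]) :
    groupAlgebraIncl L (conjAlg hLC c x) * MonoidAlgebra.of ℚ G c =
      MonoidAlgebra.of ℚ G c * groupAlgebraIncl L x := by
  induction x using MonoidAlgebra.induction_linear with
  | zero => simp
  | add x y hx hy => simp only [map_add, add_mul, mul_add, hx, hy]
  | single l r =>
    simp [conjAlg, MonoidAlgebra.of_apply, MonoidAlgebra.single_mul_single, coe_conjEquiv]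

theorem incl_injective (L : Subgroup G) : Function.Injective (groupAlgebraIncl L) :=
  MonoidAlgebra.mapDomain_injective L.subtype_injective

theorem of_mul_cancel {c : G} {x y : ℚ[G]}
    (h : x * MonoidAlgebra.of ℚ G c = y * MonoidAlgebra.of ℚ G c) : x = y := by
  have h2 : MonoidAlgebra.of ℚ G c * MonoidAlgebra.of ℚ G c⁻¹ = 1 := by
    rw [← map_mul, mul_inv_cancel, map_one]
  have := congrArg (· * MonoidAlgebra.of ℚ G c⁻¹) h
  simpa only [mul_assoc, h2, mul_one] using this

theorem conjAlg_cen {L : Subgroup G} {e : ℚ[L]} (hc : IsMulCentral e)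
    [(L.subgroupOf (cen L e)).Normal] (c : cen L e) : conjAlg (le_cen hc) c e = e := by
  apply incl_injective
  apply of_mul_cancel (c := (c : G))
  rw [incl_conjAlg_mul]
  exact c.2

theorem twist_mem {C L : Subgroup G} [(L.subgroupOf C).Normal]
    (s : C ⧸ L.subgroupOf C → C) (hs : ∀ q, (s q : C ⧸ L.subgroupOf C) = q)
    (p q : C ⧸ L.subgroupOf C) : ((s p * s q * (s (p * q))⁻¹ : C) : G) ∈ L := by
  rw [← Subgroup.mem_subgroupOf, ← QuotientGroup.eq_one_iff]
  simp [hs]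

/-- The element `g` of `L` with `s(p) s(q) = g s(p q)`. -/
def twist {C L : Subgroup G} [(L.subgroupOf C).Normal]
    (s : C ⧸ L.subgroupOf C → C) (hs : ∀ q, (s q : C ⧸ L.subgroupOf C) = q)
    (p q : C ⧸ L.subgroupOf C) : L := ⟨_, twist_mem s hs p q⟩

theorem coe_twist_mul {C L : Subgroup G} [(L.subgroupOf C).Normal]
    (s : C ⧸ L.subgroupOf C → C) (hs : ∀ q, (s q : C ⧸ L.subgroupOf C) = q)
    (p q : C ⧸ L.subgroupOf C) :
    (twist s hs p q : G) * s (p * q) = s p * s q := by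
  simp [twist]

/-- The action and twisting of `C / L` over `ℚ L` given by a choice `s` of coset
representatives: `σ_q` is conjugation by `s(q)`, and `τ(p, q)` is the `g ∈ L` with
`s(p) s(q) = g s(p q)`. -/
def extensionSystem {C L : Subgroup G} (hLC : L ≤ C) [(L.subgroupOf C).Normal]
    (s : C ⧸ L.subgroupOf C → C) (hs : ∀ q, (s q : C ⧸ L.subgroupOf C) = q) :
    CrossedSystem ℚ[L] (C ⧸ L.subgroupOf C) where
  σ q := conjAlg hLC (s q)
  τ p q := Units.map (MonoidAlgebra.of ℚ L) (toUnits (twist s hs p q))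
  comp p q r := by
    apply incl_injective
    apply of_mul_cancel (c := (s (p * q) : G))
    have h : groupAlgebraIncl L (MonoidAlgebra.of ℚ L (twist s hs p q)) *
        MonoidAlgebra.of ℚ G (s (p * q)) =
          MonoidAlgebra.of ℚ G (s p) * MonoidAlgebra.of ℚ G (s q) := by
      rw [← map_mul, ← coe_twist_mul s hs p q, map_mul]
      simp [MonoidAlgebra.of_apply]
    simp only [Units.coe_map, val_toUnits_apply, map_mul]
    rw [mul_assoc, h, ← mul_assoc, incl_conjAlg_mul, mul_assoc, incl_conjAlg_mul, mul_assoc,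
      incl_conjAlg_mul, ← mul_assoc, ← mul_assoc, h]
  cocycle p q t := by
    have h : conjAlg hLC (s p) (MonoidAlgebra.of ℚ L (twist s hs q t)) =
        MonoidAlgebra.of ℚ L (conjEquiv hLC (s p) (twist s hs q t)) := by
      simp [conjAlg, MonoidAlgebra.of_apply]
    simp only [Units.coe_map, val_toUnits_apply]
    rw [h, ← map_mul, ← map_mul]
    congr 1
    apply Subtype.ext
    simp [coe_conjEquiv, twist, mul_assoc]

/-- The action `σ` and the twisting `τ` of `Cen_G(e) / L` over `ℚ L e`, for a central idempotent
`e` of `ℚ L` such that `L ⊴ Cen_G(e)`, and a choice `s` of coset representatives: `σ_q` is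
conjugation by `s(q)`, and `τ(p, q) = g e` for the `g ∈ L` with `s(p) s(q) = g s(p q)`. -/
def cenSystem {L : Subgroup G} {e : ℚ[L]} (he : IsIdempotentElem e) (hc : IsMulCentral e)
    [(L.subgroupOf (cen L e)).Normal] (s : cen L e ⧸ L.subgroupOf (cen L e) → cen L e)
    (hs : ∀ q, (s q : cen L e ⧸ L.subgroupOf (cen L e)) = q) :
    CrossedSystem he.Corner (cen L e ⧸ L.subgroupOf (cen L e)) :=
  (extensionSystem (le_cen hc) s hs).corner he hc fun q => conjAlg_cen hc (s q)

end Groups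

/-! Characters -/

section Characters

variable {G : Type*} [Group G]

/-- The induced character `χ^G`: `χ^G(g) = |H|⁻¹ ∑_{x ∈ G} χ°(x⁻¹ g x)`, where `χ°` is `χ`
extended by zero from `H` to `G`. -/
def inducedCharacter (H : Subgroup G) (χ : H → ℂ) (g : G) : ℂ :=
  (Nat.card H : ℂ)⁻¹ * ∑ᶠ x : G, Function.extend ((↑) : H → G) χ 0 (x⁻¹ * g * x)

/-- The field `ℚ(χ)` of character values. -/
abbrev characterField (χ : G → ℂ) : IntermediateField ℚ ℂ :=
  IntermediateField.adjoin ℚ (Set.range χ)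

/-- The value `χ(g)` as an element of `ℚ(χ)`. -/
def characterValue (χ : G → ℂ) (g : G) : characterField χ :=
  ⟨χ g, IntermediateField.subset_adjoin ℚ _ ⟨g, rfl⟩⟩

/-- The element
`e_ℚ(χ) = (χ(1) / |G|) ∑_{σ ∈ Gal(ℚ(χ)/ℚ)} ∑_{g ∈ G} σ(χ(g)) g⁻¹`, as an element of `ℂ G`. -/
def rationalIdempotent (χ : G → ℂ) : ℂ[G] :=
  (χ 1 / (Nat.card G : ℂ)) • ∑ᶠ σ : characterField χ ≃ₐ[ℚ] characterField χ, ∑ᶠ g : G,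
    MonoidAlgebra.single g⁻¹ (σ (characterValue χ g) : ℂ)

/-- The assertion that `e ∈ ℚ G` is `e_ℚ(χ)`, under the inclusion `ℚ G ⊆ ℂ G`. -/
def IsRationalIdempotent (χ : G → ℂ) (e : ℚ[G]) : Prop :=
  MonoidAlgebra.mapRingHom G (algebraMap ℚ ℂ) e = rationalIdempotent χ

/-- A linear character of `H`, as a complex valued function. -/
def linearCharacter {H : Subgroup G} (ψ : H →* ℂˣ) : H → ℂ := fun h => ψ h

/-- The character `ψ^L`, where `ψ` is a linear character of `H ≤ L ≤ G`. -/
def inducedTo {H L : Subgroup G} (hHL : H ≤ L) (ψ : H →* ℂˣ) : L → ℂ :=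
  inducedCharacter (H.subgroupOf L) fun h =>
    linearCharacter ψ (Subgroup.subgroupOfEquivOfLe hHL h)

/-- The kernel of a linear character of `H ≤ G`, as a subgroup of `G`. -/
def kernelIn {H : Subgroup G} (ψ : H →* ℂˣ) : Subgroup G := ψ.ker.map H.subtype

/-- The restriction `ψ_A`. -/
def restrictTo {A H : Subgroup G} (hAH : A ≤ H) (ψ : H →* ℂˣ) : A →* ℂˣ :=
  ψ.comp (Subgroup.inclusion hAH)

end Characters

end

/-! Let ε be the idempotent of ℂH attached to ψ. Shoda's condition forces εgε = 0 for g ∉ H, so εℂXε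
= ℂε for X = G, and also for X = L, to which the condition descends. Hence a central z acts on ε,
and so on every conjugate of ε, by one scalar. The normalized sum of these conjugates is therefore a
central idempotent that is primitive among central idempotents, without any appeal to representation
theory. Its nontrivial Galois conjugates are orthogonal to it, so its coefficientwise trace from the
field of values is an idempotent. This trace is e_ℚ(ψ^X), again primitive among the central
idempotents of ℚX.

Put e = e_ℚ(ψ^L), C = Cen_G(e) and N = N_G(ker ψ_A). The crux is that ege = 0 for g ∉ C
(`mem_normalizer_of_conj_mul_ne_zero`, `mem_cen_of_conj_mul_ne_zero`). Since ψ_A is L-invariant, A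
acts on the complex idempotent of ψ^L through ψ_A, so comparing the action of A on e and on geg⁻¹
shows that geg⁻¹·e ≠ 0 implies g ∈ N. Then g normalizes L, geg⁻¹ is a central idempotent of ℚL, and
primitivity gives geg⁻¹ = e. In particular C ≤ N, whence L ⊴ C.

The sum of the n distinct conjugates of e is now a nonzero central idempotent of ℚG lying under
e_ℚ(ψ^G), hence equal to it by primitivity. With t_i running over representatives of G/C, the
elements t_i e and e t_i⁻¹ satisfy the matrix unit relations, so ℚG e_ℚ(ψ^G) ≅ M_n(eℚGe). By
orthogonality only C contributes to eℚGe, and splitting C into cosets of L identifies eℚGe with the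
crossed product. -/

noncomputable section

/-! ### The complex central idempotent of an induced linear character -/

section InducedIdempotent

open MonoidAlgebra

variable {X : Type*} [Group X]

/-- The condition of Shoda for the character induced by `ψ` to be irreducible. -/
def ShodaCondition {H : Subgroup X} (ψ : H →* ℂˣ) : Prop :=
  ∀ g : X, g ∉ H → ∃ h h' : H, (h' : X) = g⁻¹ * h * g ∧ ψ h' ≠ ψ h

/-- The idempotent of `ℂ X` attached to a linear character of a subgroup of `X`. -/
def linearIdempotent {H : Subgroup X} [Fintype H] (ψ : H →* ℂˣ) : ℂ[X] :=
  (Nat.card H : ℂ)⁻¹ • ∑ h : H, single (h : X)⁻¹ (ψ h : ℂ)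

/-- The sum of the distinct conjugates of `linearIdempotent ψ` when `ψ` satisfies Shoda's
condition. -/
def inducedIdempotent [Fintype X] {H : Subgroup X} [Fintype H] (ψ : H →* ℂˣ) : ℂ[X] :=
  (Nat.card H : ℂ)⁻¹ • ∑ x : X, of ℂ X x * linearIdempotent ψ * of ℂ X x⁻¹

theorem of_mul_of_inv (k : Type*) [CommRing k] (x : X) : of k X x * of k X x⁻¹ = 1 := by
  rw [← map_mul, mul_inv_cancel, map_one]

theorem of_inv_mul_of (k : Type*) [CommRing k] (x : X) : of k X x⁻¹ * of k X x = 1 := by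
  rw [← map_mul, inv_mul_cancel, map_one]

theorem commute_of_forall_of {k : Type*} [CommRing k] {e : k[X]}
    (h : ∀ x, of k X x * e = e * of k X x) (w : k[X]) : w * e = e * w := by
  induction w using MonoidAlgebra.induction_linear with
  | zero => simp
  | add a b ha hb => rw [add_mul, mul_add, ha, hb]
  | single g r =>
    have : (single g r : k[X]) = r • of k X g := by simp [of_apply]
    rw [this, smul_mul_assoc, mul_smul_comm, h]

theorem extend_val_of_mem {H : Subgroup X} (χ : H → ℂ) {g : X} (hg : g ∈ H) :
    Function.extend ((↑) : H → X) χ 0 g = χ ⟨g, hg⟩ :=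
  Subtype.val_injective.extend_apply χ 0 ⟨g, hg⟩

section Linear

variable {H : Subgroup X} [Fintype H] (ψ : H →* ℂˣ)

theorem of_mul_linearIdempotent (h : H) :
    of ℂ X h * linearIdempotent ψ = (ψ h : ℂ) • linearIdempotent ψ := by
  rw [linearIdempotent, mul_smul_comm, smul_comm, Finset.mul_sum,
    Finset.smul_sum (r := (ψ h : ℂ))]
  congr 1
  refine Fintype.sum_equiv (Equiv.mulRight h⁻¹) _ _ fun x => ?_
  simp [of_apply]
  rw [mul_left_comm, mul_inv_cancel₀ (Units.ne_zero _), mul_one]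

theorem linearIdempotent_mul_of (h : H) :
    linearIdempotent ψ * of ℂ X h = (ψ h : ℂ) • linearIdempotent ψ := by
  rw [linearIdempotent, smul_mul_assoc, smul_comm, Finset.sum_mul,
    Finset.smul_sum (r := (ψ h : ℂ))]
  congr 1
  refine Fintype.sum_equiv (Equiv.mulLeft h⁻¹) _ _ fun x => ?_
  simp [of_apply]

theorem linearIdempotent_mul_self :
    linearIdempotent ψ * linearIdempotent ψ = linearIdempotent ψ := by
  have h0 : (Nat.card H : ℂ) ≠ 0 := Nat.cast_ne_zero.2 Nat.card_pos.ne'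
  conv_lhs => enter [1]; rw [linearIdempotent]
  rw [smul_mul_assoc, Finset.sum_mul]
  have : ∀ h : H, single (h : X)⁻¹ (ψ h : ℂ) * linearIdempotent ψ = linearIdempotent ψ := by
    intro h
    have h1 := of_mul_linearIdempotent ψ h⁻¹
    have h2 : (single (h : X)⁻¹ (ψ h : ℂ) : ℂ[X]) = (ψ h : ℂ) • of ℂ X (h⁻¹ : H) := by
      simp [of_apply]
    rw [h2, smul_mul_assoc, h1, smul_smul, ← Units.val_mul, ← map_mul]
    simp
  rw [Finset.sum_congr rfl fun h _ => this h, Finset.sum_const, Finset.card_univ,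
    ← Nat.card_eq_fintype_card, ← Nat.cast_smul_eq_nsmul ℂ, smul_smul, inv_mul_cancel₀ h0, one_smul]

theorem linearIdempotent_ne_zero : linearIdempotent ψ ≠ 0 := by
  classical
  intro h
  have h1 := congrArg (fun w : ℂ[X] => w.coeff 1) h
  simp only [linearIdempotent, coeff_smul, coeff_sum, Finsupp.smul_apply, Finsupp.finsetSum_apply,
    coeff_single, Finsupp.single_apply, inv_eq_one, OneMemClass.coe_eq_one, coeff_zero,
    Finsupp.coe_zero, Pi.zero_apply, smul_eq_mul] at h1
  simp at h1

variable {ψ}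

/-- With hg = gh', moving h to the left idempotent and h' to the right one scales εgε by ψ(h) and by
ψ(h'), which differ. -/
theorem linearIdempotent_mul_of_mul (hψ : ShodaCondition ψ) {g : X} (hg : g ∉ H) :
    linearIdempotent ψ * of ℂ X g * linearIdempotent ψ = 0 := by
  obtain ⟨h, h', hh, hne⟩ := hψ g hg
  set ε := linearIdempotent ψ
  have h1 : (ψ h : ℂ) • (ε * of ℂ X g * ε) = (ψ h' : ℂ) • (ε * of ℂ X g * ε) := by
    rw [← smul_mul_assoc, ← smul_mul_assoc, ← linearIdempotent_mul_of, ← mul_smul_comm,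
      ← of_mul_linearIdempotent, mul_assoc ε, ← map_mul, ← mul_assoc, mul_assoc ε (of ℂ X g),
      ← map_mul, hh]
    simp only [mul_assoc, mul_inv_cancel_left, ε]
  rw [← sub_eq_zero, ← sub_smul, smul_eq_zero] at h1
  refine h1.resolve_left fun h2 => hne (Units.ext (sub_eq_zero.1 h2).symm)

/-- Elements of H act on ε by scalars and all others are killed. This plays the role of
irreducibility of the induced representation. -/
theorem exists_linearIdempotent_mul_mul (hψ : ShodaCondition ψ) (w : ℂ[X]) :
    ∃ c : ℂ, linearIdempotent ψ * w * linearIdempotent ψ = c • linearIdempotent ψ := by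
  induction w using MonoidAlgebra.induction_linear with
  | zero => exact ⟨0, by simp⟩
  | add a b ha hb =>
    obtain ⟨c, hc⟩ := ha
    obtain ⟨d, hd⟩ := hb
    exact ⟨c + d, by rw [mul_add, add_mul, hc, hd, add_smul]⟩
  | single g r =>
    have h2 : (single g r : ℂ[X]) = r • of ℂ X g := by simp [of_apply]
    rw [h2, mul_smul_comm, smul_mul_assoc]
    by_cases hg : g ∈ H
    · refine ⟨r * ψ ⟨g, hg⟩, ?_⟩
      rw [show of ℂ X g = of ℂ X (⟨g, hg⟩ : H) from rfl, linearIdempotent_mul_of, smul_mul_assoc,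
        linearIdempotent_mul_self, smul_smul]
    · exact ⟨0, by rw [linearIdempotent_mul_of_mul hψ hg, smul_zero, zero_smul]⟩

variable [Fintype X]

/-- Only the conjugates by x ∈ H survive; each equals ε, and the |H| copies cancel the normalizing
factor. -/
theorem linearIdempotent_mul_inducedIdempotent (hψ : ShodaCondition ψ) :
    linearIdempotent ψ * inducedIdempotent ψ = linearIdempotent ψ := by
  classical
  have h0 : (Nat.card H : ℂ) ≠ 0 := Nat.cast_ne_zero.2 Nat.card_pos.ne'
  have key : ∀ x : X, linearIdempotent ψ * (of ℂ X x * linearIdempotent ψ * of ℂ X x⁻¹) =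
      if x ∈ H then linearIdempotent ψ else 0 := by
    intro x
    split_ifs with hx
    · have h1 := of_mul_linearIdempotent ψ ⟨x, hx⟩
      have h2 := linearIdempotent_mul_of ψ ⟨x, hx⟩
      simp only at h1 h2
      rw [h1, ← h2, mul_assoc (linearIdempotent ψ), of_mul_of_inv, mul_one,
        linearIdempotent_mul_self]
    · rw [← mul_assoc, ← mul_assoc, linearIdempotent_mul_of_mul hψ hx, zero_mul]
  rw [inducedIdempotent, mul_smul_comm, Finset.mul_sum, Finset.sum_congr rfl fun x _ => key x,
    ← Finset.sum_filter, Finset.sum_const, ← Fintype.card_subtype, ← Nat.card_eq_fintype_card,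
    ← Nat.cast_smul_eq_nsmul ℂ, smul_smul]
  erw [inv_mul_cancel₀ h0]
  rw [one_smul]

variable (ψ) in
theorem inducedIdempotent_comm (w : ℂ[X]) :
    w * inducedIdempotent ψ = inducedIdempotent ψ * w := by
  refine commute_of_forall_of (fun y => ?_) w
  rw [inducedIdempotent, mul_smul_comm, smul_mul_assoc, Finset.mul_sum, Finset.sum_mul]
  congr 1
  refine Fintype.sum_equiv (Equiv.mulLeft y) _ _ fun x => ?_
  simp only [Equiv.coe_mulLeft, mul_inv_rev, map_mul, mul_assoc, of_inv_mul_of, mul_one]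

theorem inducedIdempotent_ne_zero (hψ : ShodaCondition ψ) : inducedIdempotent ψ ≠ 0 := by
  intro h
  have := linearIdempotent_mul_inducedIdempotent hψ
  rw [h, mul_zero] at this
  exact linearIdempotent_ne_zero ψ this.symm

/-- A form of Schur's lemma: zε = εzε is a multiple of ε, and since z is central the same scalar
serves for every conjugate of ε. -/
theorem exists_mul_inducedIdempotent (hψ : ShodaCondition ψ) {z : ℂ[X]}
    (hz : ∀ w, w * z = z * w) : ∃ c : ℂ, z * inducedIdempotent ψ = c • inducedIdempotent ψ := by
  obtain ⟨c, hc⟩ := exists_linearIdempotent_mul_mul hψ z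
  rw [hz, mul_assoc, linearIdempotent_mul_self] at hc
  refine ⟨c, ?_⟩
  rw [inducedIdempotent, mul_smul_comm, smul_comm c, Finset.mul_sum, Finset.smul_sum (r := c)]
  congr 1
  refine Finset.sum_congr rfl fun x _ => ?_
  rw [← mul_assoc, ← mul_assoc, ← hz, mul_assoc (of ℂ X x), hc, mul_smul_comm, smul_mul_assoc]

theorem mul_inducedIdempotent_eq_self {w : ℂ[X]} (hw : ∀ y, y * w = w * y)
    (h : linearIdempotent ψ * w = linearIdempotent ψ) :
    inducedIdempotent ψ * w = inducedIdempotent ψ := by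
  rw [inducedIdempotent, smul_mul_assoc, Finset.sum_mul]
  congr 1
  refine Finset.sum_congr rfl fun x _ => ?_
  rw [mul_assoc, hw, ← mul_assoc, mul_assoc (of ℂ X x), h]

theorem inducedIdempotent_mul_self (hψ : ShodaCondition ψ) :
    inducedIdempotent ψ * inducedIdempotent ψ = inducedIdempotent ψ :=
  mul_inducedIdempotent_eq_self (inducedIdempotent_comm ψ)
    (linearIdempotent_mul_inducedIdempotent hψ)

/-- The scalar by which z acts satisfies c² = c. -/
theorem mul_inducedIdempotent_eq_zero_or (hψ : ShodaCondition ψ) {z : ℂ[X]}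
    (hz : ∀ w, w * z = z * w) (hi : z * z = z) :
    z * inducedIdempotent ψ = 0 ∨ z * inducedIdempotent ψ = inducedIdempotent ψ := by
  obtain ⟨c, hc⟩ := exists_mul_inducedIdempotent hψ hz
  have h : (c * c - c) • inducedIdempotent ψ = 0 := by
    rw [sub_smul, mul_smul, ← hc, ← mul_smul_comm, ← hc, ← mul_assoc, hi, sub_self]
  have h2 := (smul_eq_zero.1 h).resolve_right (inducedIdempotent_ne_zero hψ)
  have h3 : c * (c - 1) = 0 := by linear_combination h2
  rcases mul_eq_zero.1 h3 with h4 | h4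
  · left; rw [hc, h4, zero_smul]
  · right; rw [hc, sub_eq_zero.1 h4, one_smul]

variable (ψ) in
-- This connects the sum of conjugates with the character formula that defines e_ℚ; the factor |H|⁻¹
-- is χ(1)/|X| for the induced character χ.
theorem inducedIdempotent_eq_sum :
    inducedIdempotent ψ = ∑ g : X, single g⁻¹
      ((Nat.card H : ℂ)⁻¹ * inducedCharacter H (linearCharacter ψ) g) := by
  classical
  have hε : linearIdempotent ψ = (Nat.card H : ℂ)⁻¹ • ∑ g : X,
      single g⁻¹ (Function.extend ((↑) : H → X) (linearCharacter ψ) 0 g) := by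
    rw [linearIdempotent]
    congr 1
    refine Finset.sum_of_injOn (Subtype.val : H → X) Subtype.val_injective.injOn
      (fun _ _ => Finset.mem_coe.2 (Finset.mem_univ _)) (fun g _ hg => ?_) fun h _ => ?_
    · rw [Function.extend_apply', Pi.zero_apply, single_zero]
      rintro ⟨h, rfl⟩
      exact hg ⟨h, by simp, rfl⟩
    · rw [extend_val_of_mem _ h.2]; rfl
  rw [inducedIdempotent, Finset.smul_sum]
  have : ∀ x : X, of ℂ X x * linearIdempotent ψ * of ℂ X x⁻¹ = (Nat.card H : ℂ)⁻¹ • ∑ g : X,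
      single g⁻¹ (Function.extend ((↑) : H → X) (linearCharacter ψ) 0 (x⁻¹ * g * x)) := by
    intro x
    rw [hε, mul_smul_comm, smul_mul_assoc, Finset.mul_sum, Finset.sum_mul]
    congr 1
    refine Fintype.sum_equiv (MulAut.conj x).toEquiv _ _ fun g => ?_
    simp [of_apply, mul_assoc]
  simp only [this]
  rw [← Finset.smul_sum, ← Finset.smul_sum, Finset.sum_comm, Finset.smul_sum, Finset.smul_sum]
  refine Finset.sum_congr rfl fun g _ => ?_
  rw [inducedCharacter, finsum_eq_sum_of_fintype, ← smul_eq_mul (a := (Nat.card H : ℂ)⁻¹),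
    ← smul_eq_mul (a := (Nat.card H : ℂ)⁻¹), ← smul_single, ← smul_single]
  congr 2
  exact (map_sum (singleAddHom g⁻¹) _ _).symm

theorem inducedCharacter_one :
    inducedCharacter H (linearCharacter ψ) 1 = (Nat.card H : ℂ)⁻¹ * Nat.card X := by
  rw [inducedCharacter, finsum_eq_sum_of_fintype]
  simp only [mul_one, inv_mul_cancel, extend_val_of_mem _ H.one_mem]
  simp [linearCharacter, show (⟨1, H.one_mem⟩ : H) = 1 from rfl]

end Linear

end InducedIdempotent

end

noncomputable section

/-! ### Descent to ℚ by the coefficientwise trace -/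

section GaloisDescent

open MonoidAlgebra

variable {k : Type*} [Field k] [Algebra ℚ k]

/-- The coefficientwise trace from `k X` to `ℚ X`. -/
def coeffTrace {X : Type*} (x : k[X]) : ℚ[X] := MonoidAlgebra.map (Algebra.trace ℚ k : k →+ ℚ) x

theorem mapRingHom_injective {R S X : Type*} [Semiring R] [Semiring S] [Monoid X] {f : R →+* S}
    (hf : Function.Injective f) : Function.Injective (mapRingHom X f) :=
  MonoidAlgebra.map_injective (f : R →+ S) hf

theorem mapRingHom_algEquiv_algebraMap {X : Type*} [Monoid X] (σ : Gal(k/ℚ)) (z : ℚ[X]) :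
    mapRingHom X (σ : k →+* k) (mapRingHom X (algebraMap ℚ k) z) =
      mapRingHom X (algebraMap ℚ k) z := by
  ext g
  simp

theorem mapRingHom_mapRingHom {R S T X : Type*} [Semiring R] [Semiring S] [Semiring T] [Monoid X]
    (f : R →+* S) (g : S →+* T) (x : R[X]) :
    mapRingHom X g (mapRingHom X f x) = mapRingHom X (g.comp f) x := by
  ext m
  simp

theorem mapRingHom_mapDomainRingHom {R S X Y : Type*} [Semiring R] [Semiring S] [Monoid X]
    [Monoid Y] (f : R →+* S) (i : X →* Y) (x : R[X]) :
    mapRingHom Y f (mapDomainRingHom R i x) = mapDomainRingHom S i (mapRingHom X f x) :=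
  congrArg (fun φ : R[X] →+* S[Y] => φ x) (mapRingHom_comp_mapDomainRingHom f i)

variable [FiniteDimensional ℚ k] [IsGalois ℚ k]

theorem mapRingHom_coeffTrace {X : Type*} [Monoid X] (x : k[X]) :
    mapRingHom X (algebraMap ℚ k) (coeffTrace x) =
      ∑ σ : Gal(k/ℚ), mapRingHom X (σ : k →+* k) x := by
  ext g
  rw [coeff_mapRingHom, coeff_sum, Finsupp.finsetSum_apply]
  simp only [coeff_mapRingHom]
  have : (coeffTrace x).coeff g = Algebra.trace ℚ k (x.coeff g) := by simp [coeffTrace]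
  rw [this, trace_eq_sum_automorphisms]
  rfl

/-- Each Galois automorphism fixes z and w, so the hypothesis holds for every conjugate of x; the
conjugates are then summed. -/
theorem mul_coeffTrace_eq_mul {X Y : Type*} [Monoid X] [Monoid Y] (i : X →* Y) (x : k[X])
    (z w : ℚ[Y])
    (h : mapRingHom Y (algebraMap ℚ k) z * mapDomainRingHom k i x =
      mapRingHom Y (algebraMap ℚ k) w * mapDomainRingHom k i x) :
    z * mapDomainRingHom ℚ i (coeffTrace x) = w * mapDomainRingHom ℚ i (coeffTrace x) := by
  apply mapRingHom_injective (algebraMap ℚ k).injective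
  simp only [map_mul, mapRingHom_mapDomainRingHom, mapRingHom_coeffTrace, map_sum, Finset.mul_sum]
  refine Finset.sum_congr rfl fun σ _ => ?_
  have := congrArg (mapRingHom Y (σ : k →+* k)) h
  simpa only [map_mul, mapRingHom_algEquiv_algebraMap, mapRingHom_mapDomainRingHom] using this

/-- An element with orthogonal Galois conjugates has idempotent trace. -/
theorem coeffTrace_mul_self {X : Type*} [Monoid X] (x : k[X]) (hx : x * x = x)
    (h : ∀ σ : Gal(k/ℚ), σ ≠ 1 → x * mapRingHom X (σ : k →+* k) x = 0) :
    coeffTrace x * coeffTrace x = coeffTrace x := by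
  classical
  apply mapRingHom_injective (algebraMap ℚ k).injective
  simp only [map_mul, mapRingHom_coeffTrace, Finset.sum_mul, Finset.mul_sum]
  refine Finset.sum_congr rfl fun σ _ => ?_
  rw [Finset.sum_eq_single σ, ← map_mul, hx]
  · intro τ _ hτ
    -- The cross term τ(x)σ(x) is τ applied to x·(τ⁻¹σ)(x), which vanishes when τ ≠ σ.
    have h1 := congrArg (mapRingHom X (τ : k →+* k)) (h (τ⁻¹ * σ) fun h2 => hτ
      (inv_mul_eq_one.1 h2))
    rw [map_mul, map_zero, mapRingHom_mapRingHom] at h1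
    have h2 : (τ : k →+* k).comp ((τ⁻¹ * σ : Gal(k/ℚ)) : k →+* k) = (σ : k →+* k) := by
      ext a
      simp
    rwa [h2] at h1
  · simp

theorem coeffTrace_comm {X : Type*} [Group X] (x : k[X]) (hx : ∀ w, w * x = x * w) (w : ℚ[X]) :
    w * coeffTrace x = coeffTrace x * w := by
  apply mapRingHom_injective (algebraMap ℚ k).injective
  simp only [map_mul, mapRingHom_coeffTrace, Finset.sum_mul, Finset.mul_sum]
  refine Finset.sum_congr rfl fun σ _ => ?_
  have := congrArg (mapRingHom X (σ : k →+* k)) (hx (mapRingHom X (algebraMap ℚ k) w))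
  simpa only [map_mul, mapRingHom_algEquiv_algebraMap] using this

end GaloisDescent

/-! ### The rational idempotent of an induced linear character -/

section RationalInducedIdempotent

open MonoidAlgebra

variable {X : Type*} [Group X] {H : Subgroup X} (ψ : H →* ℂˣ)

/-- The field of values of the character induced by `ψ`. -/
abbrev inducedField : IntermediateField ℚ ℂ :=
  characterField (inducedCharacter H (linearCharacter ψ))

/-- The values of ψ are |H|-th roots of unity, so the field of values sits in a cyclotomic field,
which is abelian over ℚ; its subfields are then abelian Galois too. -/
theorem inducedField_isAbelianGalois [Finite X] :
    FiniteDimensional ℚ (inducedField ψ) ∧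
      IsAbelianGalois ℚ (inducedField ψ) := by
  have := Fintype.ofFinite X
  have hn : NeZero (Nat.card H) := ⟨Nat.card_pos.ne'⟩
  obtain ⟨ζ, hζ⟩ : ∃ ζ : ℂ, IsPrimitiveRoot ζ (Nat.card H) :=
    ⟨_, Complex.isPrimitiveRoot_exp _ hn.out⟩
  have hint : IsIntegral ℚ ζ := (hζ.isIntegral Nat.card_pos).tower_top
  have hcyc : IsCyclotomicExtension {Nat.card H} ℚ (IntermediateField.adjoin ℚ {ζ}) := by
    change IsCyclotomicExtension {Nat.card H} ℚ (IntermediateField.adjoin ℚ {ζ}).toSubalgebra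
    rw [IntermediateField.adjoin_simple_toSubalgebra_of_isAlgebraic hint.isAlgebraic]
    exact hζ.adjoin_isCyclotomicExtension ℚ
  have hψmem : ∀ h : H, (ψ h : ℂ) ∈ IntermediateField.adjoin ℚ {ζ} := by
    intro h
    have h1 : (ψ h : ℂ) ^ Nat.card H = 1 := by
      rw [← Units.val_pow_eq_pow_val, ← map_pow, pow_card_eq_one', map_one, Units.val_one]
    obtain ⟨i, -, hi⟩ := hζ.eq_pow_of_pow_eq_one h1
    rw [← hi]
    exact pow_mem (IntermediateField.mem_adjoin_simple_self ℚ ζ) i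
  have hle : inducedField ψ ≤
      IntermediateField.adjoin ℚ {ζ} := by
    rw [IntermediateField.adjoin_le_iff]
    rintro _ ⟨g, rfl⟩
    rw [inducedCharacter, finsum_eq_sum_of_fintype]
    refine mul_mem (inv_mem (natCast_mem _ _)) (sum_mem fun x _ => ?_)
    by_cases hx : x⁻¹ * g * x ∈ H
    · rw [extend_val_of_mem _ hx]
      exact hψmem _
    · rw [Function.extend_apply' _ _ _ (by rintro ⟨h, hh⟩; exact hx (hh ▸ h.2))]
      exact zero_mem _
  have h1 := IsCyclotomicExtension.isAbelianGalois {Nat.card H} ℚ (IntermediateField.adjoin ℚ {ζ})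
  have h2 : FiniteDimensional ℚ (IntermediateField.adjoin ℚ {ζ}) :=
    IsCyclotomicExtension.finite {Nat.card H} ℚ _
  exact ⟨FiniteDimensional.of_injective (IntermediateField.inclusion hle).toRingHom.toRatAlgHom.toLinearMap
    (IntermediateField.inclusion hle).injective,
    IsAbelianGalois.of_algHom (IntermediateField.inclusion hle).toRingHom.toRatAlgHom⟩

variable [Fintype X]

/-- The idempotent `inducedIdempotent ψ` as an element of the group algebra over the field of
values of the induced character. -/
def valuedIdempotent : (inducedField ψ)[X] :=
  ∑ g : X, single g⁻¹ ((Nat.card H : inducedField ψ)⁻¹ *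
    characterValue _ g)

theorem coeff_valuedIdempotent (g : X) : (valuedIdempotent ψ).coeff g =
    (Nat.card H : inducedField ψ)⁻¹ *
      characterValue _ g⁻¹ := by
  classical
  rw [valuedIdempotent, coeff_sum, Finsupp.finsetSum_apply, Finset.sum_eq_single g⁻¹]
  · simp
  · intro b _ hb
    rw [coeff_single, Finsupp.single_apply, if_neg]
    rintro rfl
    simp at hb
  · simp

variable [Fintype H]

theorem mapRingHom_valuedIdempotent :
    mapRingHom X (algebraMap _ ℂ) (valuedIdempotent ψ) = inducedIdempotent ψ := by
  rw [inducedIdempotent_eq_sum, valuedIdempotent, map_sum]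
  refine Finset.sum_congr rfl fun g _ => ?_
  rw [mapRingHom_single, map_mul, map_inv₀, map_natCast]
  rfl

variable {ψ}

/-- By primitivity over ℂ, σ(E)E is 0 or E. In the second case σ(E) = E, so σ fixes the coefficients
of E; up to the rational factor |H|⁻¹ these are the character values, which generate the field, and
σ = 1. -/
theorem valuedIdempotent_mul_conj (hψ : ShodaCondition ψ) :
    ∀ σ : Gal(inducedField ψ/ℚ), σ ≠ 1 →
    valuedIdempotent ψ * mapRingHom X (σ : _ →+* _) (valuedIdempotent ψ) = 0 := by
  have hinj : Function.Injective (mapRingHom X (algebraMap (inducedField ψ) ℂ)) :=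
    mapRingHom_injective (algebraMap (inducedField ψ) ℂ).injective
  set E := valuedIdempotent ψ
  have hE : mapRingHom X (algebraMap (inducedField ψ) ℂ) E = inducedIdempotent ψ := mapRingHom_valuedIdempotent ψ
  have hne : E ≠ 0 := by
    intro h
    rw [h, map_zero] at hE
    exact inducedIdempotent_ne_zero hψ hE.symm
  have hidem : E * E = E := hinj (by rw [map_mul, hE, inducedIdempotent_mul_self hψ])
  have hcomm : ∀ w, w * E = E * w := fun w => hinj (by
    rw [map_mul, map_mul, hE, inducedIdempotent_comm])
  have hinv : ∀ (τ : Gal((inducedField ψ)/ℚ)) (x : (inducedField ψ)[X]), mapRingHom X (τ : (inducedField ψ) →+* (inducedField ψ))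
      (mapRingHom X ((τ⁻¹ : Gal((inducedField ψ)/ℚ)) : (inducedField ψ) →+* (inducedField ψ)) x) = x := by
    intro τ x
    rw [mapRingHom_mapRingHom]
    ext g
    simp
  have hcases : ∀ τ : Gal((inducedField ψ)/ℚ), mapRingHom X (τ : (inducedField ψ) →+* (inducedField ψ)) E * E = 0 ∨
      mapRingHom X (τ : (inducedField ψ) →+* (inducedField ψ)) E * E = E := by
    intro τ
    have h1 : ∀ x, of ℂ X x * mapRingHom X (algebraMap (inducedField ψ) ℂ) (mapRingHom X (τ : (inducedField ψ) →+* (inducedField ψ)) E) =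
        mapRingHom X (algebraMap (inducedField ψ) ℂ) (mapRingHom X (τ : (inducedField ψ) →+* (inducedField ψ)) E) * of ℂ X x := by
      intro x
      have := congrArg (mapRingHom X (algebraMap (inducedField ψ) ℂ)) <|
        congrArg (mapRingHom X (τ : (inducedField ψ) →+* (inducedField ψ))) (hcomm (of (inducedField ψ) X x))
      simpa [of_apply] using this
    rcases mul_inducedIdempotent_eq_zero_or hψ (commute_of_forall_of h1)
      (by rw [← map_mul, ← map_mul, hidem]) with h2 | h2
    · left
      apply hinj
      rw [map_mul, hE, h2, map_zero]
    · right
      apply hinj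
      rw [map_mul, hE, h2]
  intro σ hσ
  rw [← hcomm]
  refine (hcases σ).resolve_right fun h1 => hσ ?_
  have h2 : mapRingHom X (σ : (inducedField ψ) →+* (inducedField ψ)) E = E := by
    -- So far only σ(E)E = E is known. Applying σ to the dichotomy for σ⁻¹ gives Eσ(E) = 0, which is
    -- impossible, or Eσ(E) = σ(E).
    rcases hcases σ⁻¹ with h3 | h3
    · have h4 := congrArg (mapRingHom X (σ : (inducedField ψ) →+* (inducedField ψ))) h3
      rw [map_mul, hinv, map_zero, ← hcomm, h1] at h4
      exact absurd h4 hne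
    · have h4 := congrArg (mapRingHom X (σ : (inducedField ψ) →+* (inducedField ψ))) h3
      rw [map_mul, hinv, ← hcomm, h1] at h4
      exact h4.symm
  have h0 : (Nat.card H : (inducedField ψ)) ≠ 0 := Nat.cast_ne_zero.2 Nat.card_pos.ne'
  have h5 : (σ : (inducedField ψ) →ₐ[ℚ] (inducedField ψ)) = AlgHom.id ℚ (inducedField ψ) := by
    refine IntermediateField.adjoin_algHom_ext ℚ ?_
    rintro _ ⟨g, rfl⟩
    have h3 := congrArg (fun x : (inducedField ψ)[X] => x.coeff g⁻¹) h2
    simp only [coeff_mapRingHom, E, coeff_valuedIdempotent, inv_inv] at h3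
    simp only [RingHom.coe_coe, map_mul, map_inv₀, map_natCast] at h3
    exact mul_left_cancel₀ (inv_ne_zero h0) h3
  ext x
  exact congrArg Subtype.val (DFunLike.congr_fun h5 x)

variable (ψ) in
/-- The primitive central idempotent of `ℚ X` attached to the character induced by `ψ`. -/
def rationalInducedIdempotent : ℚ[X] := coeffTrace (valuedIdempotent ψ)

variable (ψ) in
-- The trace is the sum over the Galois group, and χ(1)/|X| = |H|⁻¹ for the induced character.
theorem isRationalIdempotent_rationalInducedIdempotent :
    IsRationalIdempotent (inducedCharacter H (linearCharacter ψ))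
      (rationalInducedIdempotent ψ) := by
  obtain ⟨_, _⟩ := inducedField_isAbelianGalois ψ
  have h1 : (algebraMap ℚ ℂ) = (algebraMap (inducedField ψ) ℂ).comp (algebraMap ℚ _) :=
    Subsingleton.elim _ _
  rw [IsRationalIdempotent, rationalIdempotent, rationalInducedIdempotent, h1,
    ← mapRingHom_mapRingHom, mapRingHom_coeffTrace, map_sum, finsum_eq_sum_of_fintype,
    Finset.smul_sum]
  refine Finset.sum_congr rfl fun σ _ => ?_
  have hX : (Nat.card X : ℂ) ≠ 0 := Nat.cast_ne_zero.2 Nat.card_pos.ne'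
  rw [inducedCharacter_one, mul_div_cancel_right₀ _ hX, finsum_eq_sum_of_fintype, Finset.smul_sum,
    valuedIdempotent, map_sum, map_sum]
  refine Finset.sum_congr rfl fun g _ => ?_
  simp only [mapRingHom_single, smul_single, smul_eq_mul, map_mul, map_inv₀, map_natCast]
  rfl

variable (ψ) in
theorem rationalInducedIdempotent_comm (w : ℚ[X]) :
    w * rationalInducedIdempotent ψ = rationalInducedIdempotent ψ * w := by
  obtain ⟨_, _⟩ := inducedField_isAbelianGalois ψ
  refine coeffTrace_comm _ (fun y => ?_) w
  apply mapRingHom_injective (algebraMap (inducedField ψ) ℂ).injective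
  rw [map_mul, map_mul, mapRingHom_valuedIdempotent, inducedIdempotent_comm]

theorem rationalInducedIdempotent_mul_self (hψ : ShodaCondition ψ) :
    rationalInducedIdempotent ψ * rationalInducedIdempotent ψ = rationalInducedIdempotent ψ := by
  obtain ⟨_, _⟩ := inducedField_isAbelianGalois ψ
  refine coeffTrace_mul_self _ ?_ (valuedIdempotent_mul_conj hψ)
  apply mapRingHom_injective (algebraMap (inducedField ψ) ℂ).injective
  rw [map_mul, mapRingHom_valuedIdempotent, inducedIdempotent_mul_self hψ]

/-- Among the Galois conjugates making up the trace, only the one for σ = 1 is not orthogonal to the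
complex idempotent. -/
theorem rationalInducedIdempotent_mul_inducedIdempotent (hψ : ShodaCondition ψ) :
    mapRingHom X (algebraMap ℚ ℂ) (rationalInducedIdempotent ψ) * inducedIdempotent ψ =
      inducedIdempotent ψ := by
  classical
  obtain ⟨_, _⟩ := inducedField_isAbelianGalois ψ
  have h1 : (algebraMap ℚ ℂ) = (algebraMap (inducedField ψ) ℂ).comp (algebraMap ℚ _) :=
    Subsingleton.elim _ _
  have hE := mapRingHom_valuedIdempotent ψ
  rw [rationalInducedIdempotent, h1, ← mapRingHom_mapRingHom, mapRingHom_coeffTrace,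
    inducedIdempotent_comm]
  conv_lhs => enter [1]; rw [← hE]
  rw [← map_mul, Finset.mul_sum, Finset.sum_eq_single 1]
  · have h2 : mapRingHom X ((1 : Gal(inducedField ψ/ℚ)) : inducedField ψ →+* inducedField ψ)
        (valuedIdempotent ψ) = valuedIdempotent ψ := by
      ext g
      simp
    rw [h2, map_mul, hE, inducedIdempotent_mul_self hψ]
  · exact fun σ _ hσ => valuedIdempotent_mul_conj hψ σ hσ
  · simp

variable (ψ) in
/-- Identities between rational left multiples of `inducedIdempotent ψ` descend to
`rationalInducedIdempotent ψ`. -/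
theorem mul_rationalInducedIdempotent_eq_mul {Y : Type*} [Group Y] (i : X →* Y) (z w : ℚ[Y])
    (h : mapRingHom Y (algebraMap ℚ ℂ) z * mapDomainRingHom ℂ i (inducedIdempotent ψ) =
      mapRingHom Y (algebraMap ℚ ℂ) w * mapDomainRingHom ℂ i (inducedIdempotent ψ)) :
    z * mapDomainRingHom ℚ i (rationalInducedIdempotent ψ) =
      w * mapDomainRingHom ℚ i (rationalInducedIdempotent ψ) := by
  obtain ⟨_, _⟩ := inducedField_isAbelianGalois ψ
  have h1 : (algebraMap ℚ ℂ) = (algebraMap (inducedField ψ) ℂ).comp (algebraMap ℚ _) :=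
    Subsingleton.elim _ _
  refine mul_coeffTrace_eq_mul i _ z w ?_
  apply mapRingHom_injective (algebraMap (inducedField ψ) ℂ).injective
  simp only [map_mul, mapRingHom_mapRingHom, mapRingHom_mapDomainRingHom,
    mapRingHom_valuedIdempotent]
  rwa [h1] at h

theorem rationalInducedIdempotent_ne_zero (hψ : ShodaCondition ψ) :
    rationalInducedIdempotent ψ ≠ 0 := by
  intro h
  have := rationalInducedIdempotent_mul_inducedIdempotent hψ
  rw [h, map_zero, zero_mul] at this
  exact inducedIdempotent_ne_zero hψ this.symm

/-- The rational idempotent is primitive among central idempotents. -/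
theorem mul_rationalInducedIdempotent_eq_zero_or (hψ : ShodaCondition ψ) {z : ℚ[X]}
    (hz : ∀ w, w * z = z * w) (hi : z * z = z) :
    z * rationalInducedIdempotent ψ = 0 ∨
      z * rationalInducedIdempotent ψ = rationalInducedIdempotent ψ := by
  have hid : ∀ w : ℂ[X], mapDomainRingHom ℂ (MonoidHom.id X) w = w := fun w => by simp
  have hid' : ∀ w : ℚ[X], mapDomainRingHom ℚ (MonoidHom.id X) w = w := fun w => by simp
  have hz' : ∀ x, of ℂ X x * mapRingHom X (algebraMap ℚ ℂ) z =
      mapRingHom X (algebraMap ℚ ℂ) z * of ℂ X x := fun x => by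
    simpa [of_apply] using congrArg (mapRingHom X (algebraMap ℚ ℂ)) (hz (of ℚ X x))
  rcases mul_inducedIdempotent_eq_zero_or hψ (commute_of_forall_of hz')
    (by rw [← map_mul, hi]) with h | h
  · left
    simpa only [hid', zero_mul] using mul_rationalInducedIdempotent_eq_mul ψ (MonoidHom.id X) z 0
      (by rw [hid, h, map_zero, zero_mul])
  · right
    simpa only [hid', one_mul] using mul_rationalInducedIdempotent_eq_mul ψ (MonoidHom.id X) z 1
      (by rw [hid, h, map_one, one_mul])

end RationalInducedIdempotent

end

noncomputable section

/-! ### Matrix units and corner rings -/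

section MatrixUnits

variable {R : Type*} [Ring R]

/-- The inclusion of the corner `e R e` in `R`. -/
def cornerVal {e : R} (he : IsIdempotentElem e) : he.Corner →ₙ+* R where
  toFun x := x.1
  map_mul' _ _ := rfl
  map_zero' := rfl
  map_add' _ _ := rfl

theorem cornerVal_injective {e : R} (he : IsIdempotentElem e) :
    Function.Injective (cornerVal he) := Subtype.val_injective

/-- An element of `R` with `e * r * e = r` as an element of the corner. -/
def cornerMk {e : R} (he : IsIdempotentElem e) (r : R) (hr : e * r * e = r) : he.Corner :=
  ⟨r, r, hr⟩

theorem cornerVal_cornerMk {e : R} (he : IsIdempotentElem e) (r : R) (hr : e * r * e = r) :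
    cornerVal he (cornerMk he r hr) = r := rfl

theorem mul_cornerVal {e : R} (he : IsIdempotentElem e) (x : he.Corner) :
    e * cornerVal he x = cornerVal he x := ((Subsemigroup.mem_corner_iff he).1 x.2).1

theorem cornerVal_mul {e : R} (he : IsIdempotentElem e) (x : he.Corner) :
    cornerVal he x * e = cornerVal he x := ((Subsemigroup.mem_corner_iff he).1 x.2).2

theorem cornerVal_cornerProj {e : R} (he : IsIdempotentElem e) (hc : IsMulCentral e) (r : R) :
    cornerVal he (cornerProj he hc r) = e * r * e := rfl

/-- If `f = ∑ a i * b i` where `b i * a j` is `e` for `i = j` and `0` otherwise, then the corner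
of `f` is a matrix ring over the corner of `e`. -/
def cornerEquivMatrix {ι : Type*} [Fintype ι] [DecidableEq ι] {e f : R} (he : IsIdempotentElem e)
    (hf : IsIdempotentElem f) (a b : ι → R) (ha : ∀ i, a i * e = a i) (hb : ∀ i, e * b i = b i)
    (hba : ∀ i j, b i * a j = if i = j then e else 0) (hab : ∑ i, a i * b i = f) :
    hf.Corner ≃+* Matrix ι ι he.Corner :=
  have hfa : ∀ i, f * a i = a i := fun i => by
    rw [← hab, Finset.sum_mul, Finset.sum_eq_single i]
    · rw [mul_assoc, hba, if_pos rfl, ha]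
    · intro j _ hj
      rw [mul_assoc, hba, if_neg hj, mul_zero]
    · simp
  have hbf : ∀ i, b i * f = b i := fun i => by
    rw [← hab, Finset.mul_sum, Finset.sum_eq_single i]
    · rw [← mul_assoc, hba, if_pos rfl, hb]
    · intro j _ hj
      rw [← mul_assoc, hba, if_neg hj.symm, zero_mul]
    · simp
  { toFun := fun x => Matrix.of fun i j => cornerMk he (b i * cornerVal hf x * a j) (by
      rw [← mul_assoc, ← mul_assoc, hb, mul_assoc, ha])
    invFun := fun M => cornerMk hf (∑ i, ∑ j, a i * cornerVal he (M i j) * b j) (by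
      simp only [Finset.mul_sum, Finset.sum_mul]
      refine Finset.sum_congr rfl fun i _ => Finset.sum_congr rfl fun j _ => ?_
      rw [← mul_assoc, ← mul_assoc, hfa, mul_assoc, hbf])
    left_inv := fun x => cornerVal_injective hf <| by
      simp only [cornerVal_cornerMk, Matrix.of_apply]
      calc ∑ i, ∑ j, a i * (b i * cornerVal hf x * a j) * b j
          = (∑ i, a i * b i) * cornerVal hf x * ∑ j, a j * b j := by
            simp only [Finset.mul_sum, Finset.sum_mul, mul_assoc]
            rw [Finset.sum_comm]
        _ = cornerVal hf x := by rw [hab, mul_cornerVal, cornerVal_mul]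
    right_inv := fun M => by
      refine Matrix.ext fun i j => cornerVal_injective he ?_
      simp only [cornerVal_cornerMk, Matrix.of_apply, Finset.mul_sum, Finset.sum_mul]
      rw [Finset.sum_eq_single i, Finset.sum_eq_single j]
      · rw [mul_assoc (a i), ← mul_assoc (b i), hba, if_pos rfl, mul_assoc, mul_assoc, hba,
          if_pos rfl, cornerVal_mul, mul_cornerVal]
      · intro l _ hl
        rw [mul_assoc, mul_assoc (a i * _), hba, if_neg hl, mul_zero, mul_zero]
      · simp
      · intro k _ hk
        refine Finset.sum_eq_zero fun l _ => ?_
        rw [mul_assoc (a k), ← mul_assoc (b i), hba, if_neg hk.symm, zero_mul, zero_mul]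
      · simp
    map_mul' := fun x y => by
      refine Matrix.ext fun i j => cornerVal_injective he ?_
      rw [Matrix.mul_apply, map_sum]
      simp only [map_mul, cornerVal_cornerMk, Matrix.of_apply]
      calc b i * (cornerVal hf x * cornerVal hf y) * a j =
            b i * (cornerVal hf x * (f * cornerVal hf y)) * a j := by rw [mul_cornerVal]
        _ = b i * (cornerVal hf x * ((∑ k, a k * b k) * cornerVal hf y)) * a j := by rw [hab]
        _ = _ := by
          simp only [Finset.mul_sum, Finset.sum_mul, mul_assoc]
    map_add' := fun x y => by
      refine Matrix.ext fun i j => cornerVal_injective he ?_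
      rw [Matrix.add_apply, map_add]
      simp only [map_add, cornerVal_cornerMk, Matrix.of_apply]
      rw [mul_add, add_mul] }

/-- An injective multiplicative additive map whose range is the corner of `e`. -/
def equivCorner {S : Type*} [Ring S] {e : R} (he : IsIdempotentElem e) (φ : S →+ R)
    (hmul : ∀ x y, φ (x * y) = φ x * φ y) (hinj : Function.Injective φ)
    (hmem : ∀ x, e * φ x * e = φ x) (hsurj : ∀ w, ∃ x, φ x = e * w * e) : S ≃+* he.Corner :=
  let ρ : S →ₙ+* he.Corner :=
    { toFun := fun x => cornerMk he (φ x) (hmem x)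
      map_mul' := fun x y => cornerVal_injective he (hmul x y)
      map_zero' := cornerVal_injective he (map_zero φ)
      map_add' := fun x y => cornerVal_injective he (map_add φ x y) }
  RingEquiv.ofBijective ρ ⟨fun _ _ h => hinj (congrArg (cornerVal he) h), by
    rintro ⟨_, w, rfl⟩
    obtain ⟨x, hx⟩ := hsurj w
    exact ⟨x, cornerVal_injective he hx⟩⟩

end MatrixUnits

/-! ### The crossed product as a corner of ℚG -/

section CrossedProductCorner

open MonoidAlgebra

variable {G : Type*} [Group G] {L : Subgroup G} {e : ℚ[L]} (he : IsIdempotentElem e)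
  (hc : IsMulCentral e) [(L.subgroupOf (cen L e)).Normal]
  (s : cen L e ⧸ L.subgroupOf (cen L e) → cen L e)
  (hs : ∀ q, (s q : cen L e ⧸ L.subgroupOf (cen L e)) = q)

/-- The additive map `∑ r_q u_q ↦ ∑ r_q s(q)` from the crossed product to `ℚ G`. -/
def crossedToGroupAlgebra : CrossedProduct (cenSystem he hc s hs) →+ ℚ[G] where
  toFun y := y.coeff.sum fun q r => groupAlgebraIncl L (cornerVal he r) * of ℚ G (s q)
  map_zero' := Finsupp.sum_zero_index
  map_add' x y := by
    rw [CrossedProduct.coeff_add]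
    exact Finsupp.sum_add_index' (fun q => by rw [map_zero, map_zero, zero_mul])
      fun q r t => by rw [map_add, map_add, add_mul]

theorem crossedToGroupAlgebra_single (q : cen L e ⧸ L.subgroupOf (cen L e)) (r : he.Corner) :
    crossedToGroupAlgebra he hc s hs (CrossedProduct.single _ q r) =
      groupAlgebraIncl L (cornerVal he r) * of ℚ G (s q) := by
  refine Finsupp.sum_single_index
    (h := fun q r => groupAlgebraIncl L (cornerVal he r) * of ℚ G (s q)) ?_
  rw [map_zero, map_zero, zero_mul]

omit [(L.subgroupOf (cen L e)).Normal] in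
theorem incl_mul_of_cen (c : cen L e) :
    of ℚ G c * groupAlgebraIncl L e = groupAlgebraIncl L e * of ℚ G c := c.2

theorem cornerVal_cenSystem_σ (q : cen L e ⧸ L.subgroupOf (cen L e)) (r : he.Corner) :
    cornerVal he ((cenSystem he hc s hs).σ q r) = conjAlg (le_cen hc) (s q) (cornerVal he r) :=
  rfl

theorem cornerVal_cenSystem_τ (p q : cen L e ⧸ L.subgroupOf (cen L e)) :
    cornerVal he ((cenSystem he hc s hs).τ p q) = e * of ℚ L (twist s hs p q) * e :=
  rfl

theorem groupAlgebraIncl_of (l : L) : groupAlgebraIncl L (of ℚ L l) = of ℚ G l := by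
  simp [of_apply]

theorem crossedToGroupAlgebra_mul (x y : CrossedProduct (cenSystem he hc s hs)) :
    crossedToGroupAlgebra he hc s hs (x * y) =
      crossedToGroupAlgebra he hc s hs x * crossedToGroupAlgebra he hc s hs y := by
  induction x using CrossedProduct.induction_on with
  | h0 => rw [zero_mul, map_zero, zero_mul]
  | ha x x' hx hx' => rw [add_mul, map_add, map_add, add_mul, hx, hx']
  | hs a r =>
    induction y using CrossedProduct.induction_on with
    | h0 => rw [mul_zero, map_zero, mul_zero]
    | ha y y' hy hy' => rw [mul_add, map_add, map_add, mul_add, hy, hy']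
    | hs b t =>
      rw [CrossedProduct.single_mul_single, crossedToGroupAlgebra_single,
        crossedToGroupAlgebra_single, crossedToGroupAlgebra_single]
      -- The factors e in the twisting are absorbed, since e is central in ℚL and is the identity of
      -- the corner.
      have h1 : cornerVal he (r * (cenSystem he hc s hs).σ a t * (cenSystem he hc s hs).τ a b) =
          cornerVal he r * conjAlg (le_cen hc) (s a) (cornerVal he t) *
            of ℚ L (twist s hs a b) := by
        have h2 := cornerVal_mul he ((cenSystem he hc s hs).σ a t)
        rw [map_mul, map_mul, cornerVal_cenSystem_τ, ← cornerVal_cenSystem_σ he hc s hs, mul_assoc e,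
          ← (hc.comm (of ℚ L (twist s hs a b))).eq, ← mul_assoc e, he.eq, mul_assoc,
          ← mul_assoc _ e, h2, mul_assoc]
      have h3 : of ℚ G (twist s hs a b) * of ℚ G (s (a * b)) = of ℚ G (s a) * of ℚ G (s b) := by
        rw [← map_mul, coe_twist_mul, map_mul]
      rw [h1, map_mul, map_mul, groupAlgebraIncl_of, mul_assoc, h3, mul_assoc,
        ← mul_assoc (groupAlgebraIncl L (conjAlg (le_cen hc) (s a) _)), incl_conjAlg_mul]
      simp only [mul_assoc]

theorem crossedToGroupAlgebra_mem_corner (y : CrossedProduct (cenSystem he hc s hs)) :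
    groupAlgebraIncl L e * crossedToGroupAlgebra he hc s hs y * groupAlgebraIncl L e =
      crossedToGroupAlgebra he hc s hs y := by
  induction y using CrossedProduct.induction_on with
  | h0 => rw [map_zero, mul_zero, zero_mul]
  | ha y y' hy hy' => rw [map_add, mul_add, add_mul, hy, hy']
  | hs b t =>
    rw [crossedToGroupAlgebra_single, ← mul_assoc, ← map_mul, mul_cornerVal, mul_assoc,
      incl_mul_of_cen, ← mul_assoc, ← map_mul, cornerVal_mul]

theorem coeff_incl_of_notMem {g : G} (hg : g ∉ L) (x : ℚ[L]) :
    (groupAlgebraIncl L x).coeff g = 0 := by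
  induction x using MonoidAlgebra.induction_linear with
  | zero => simp
  | add a b ha hb => rw [map_add, coeff_add, Finsupp.add_apply, ha, hb, add_zero]
  | single l r =>
    classical
    rw [mapDomainRingHom_apply, mapDomain_single, coeff_single, Finsupp.single_apply, if_neg]
    rintro rfl
    exact hg l.2

theorem coeff_incl (l : L) (x : ℚ[L]) : (groupAlgebraIncl L x).coeff l = x.coeff l := by
  classical
  induction x using MonoidAlgebra.induction_linear with
  | zero => simp
  | add a b ha hb => rw [map_add, coeff_add, Finsupp.add_apply, ha, hb, coeff_add,
      Finsupp.add_apply]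
  | single m r =>
    rw [mapDomainRingHom_apply, mapDomain_single, coeff_single, coeff_single, Finsupp.single_apply,
      Finsupp.single_apply]
    simp

/-- The cosets L s(q) are disjoint, so each coefficient of y can be read off its image; injectivity
follows. -/
theorem coeff_crossedToGroupAlgebra (y : CrossedProduct (cenSystem he hc s hs))
    (q : cen L e ⧸ L.subgroupOf (cen L e)) (l : L) :
    (crossedToGroupAlgebra he hc s hs y).coeff (l * s q) = (cornerVal he (y.coeff q)).coeff l := by
  classical
  induction y using CrossedProduct.induction_on with
  | h0 => rw [map_zero]; rfl
  | ha y y' hy hy' =>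
    rw [map_add, coeff_add, Finsupp.add_apply, hy, hy', CrossedProduct.coeff_add,
      Finsupp.add_apply, map_add, coeff_add, Finsupp.add_apply]
  | hs b t =>
    rw [crossedToGroupAlgebra_single, of_apply, coeff_mul_single_apply, mul_one]
    by_cases h : b = q
    · subst h
      rw [mul_inv_cancel_right, coeff_incl]
      simp [CrossedProduct.single]
    · rw [coeff_incl_of_notMem]
      · simp only [CrossedProduct.single]
        rw [Finsupp.single_eq_of_ne (Ne.symm h), map_zero, coeff_zero, Finsupp.zero_apply]
      · intro hmem
        apply h
        have h1 : (s q : G) * (s b : G)⁻¹ ∈ L := by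
          rw [mul_assoc] at hmem
          exact (L.mul_mem_cancel_left l.2).1 hmem
        have h2 : s q * (s b)⁻¹ ∈ L.subgroupOf (cen L e) := h1
        rw [← QuotientGroup.eq_one_iff, QuotientGroup.mk_mul, QuotientGroup.mk_inv, hs, hs,
          mul_inv_eq_one] at h2
        exact h2.symm

theorem crossedToGroupAlgebra_injective :
    Function.Injective (crossedToGroupAlgebra he hc s hs) := by
  intro x y h
  ext1
  refine Finsupp.ext fun q => cornerVal_injective he ?_
  ext l
  rw [← coeff_crossedToGroupAlgebra, ← coeff_crossedToGroupAlgebra, h]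

/-- An element of Cen_G(e) has the form l·s(q) with l ∈ L and commutes with e, so it comes from the
crossed product; the other group elements contribute 0 by orthogonality. -/
theorem exists_crossedToGroupAlgebra_eq
    (hortho : ∀ g ∉ cen L e, groupAlgebraIncl L e * of ℚ G g * groupAlgebraIncl L e = 0)
    (w : ℚ[G]) : ∃ y, crossedToGroupAlgebra he hc s hs y =
      groupAlgebraIncl L e * w * groupAlgebraIncl L e := by
  induction w using MonoidAlgebra.induction_linear with
  | zero => exact ⟨0, by rw [map_zero, mul_zero, zero_mul]⟩
  | add a b ha hb =>
    obtain ⟨y, hy⟩ := ha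
    obtain ⟨z, hz⟩ := hb
    exact ⟨y + z, by rw [map_add, mul_add, add_mul, hy, hz]⟩
  | single g r =>
    by_cases hg : g ∈ cen L e
    · set q : cen L e ⧸ L.subgroupOf (cen L e) := QuotientGroup.mk ⟨g, hg⟩ with hq
      have hl : g * (s q : G)⁻¹ ∈ L := by
        have h2 : (⟨g, hg⟩ : cen L e) * (s q)⁻¹ ∈ L.subgroupOf (cen L e) := by
          rw [← QuotientGroup.eq_one_iff, QuotientGroup.mk_mul, QuotientGroup.mk_inv, hs, ← hq,
            mul_inv_cancel]
        exact h2
      refine ⟨CrossedProduct.single _ q (cornerProj he hc (single ⟨_, hl⟩ r)), ?_⟩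
      rw [crossedToGroupAlgebra_single]
      have h1 : (single g r : ℚ[G]) =
          groupAlgebraIncl L (single ⟨_, hl⟩ r) * of ℚ G (s q) := by
        simp [of_apply]
      rw [h1, cornerVal_cornerProj, map_mul, map_mul, mul_assoc, ← incl_mul_of_cen]
      simp only [mul_assoc]
    · refine ⟨0, ?_⟩
      have h1 : (single g r : ℚ[G]) = r • of ℚ G g := by simp [of_apply]
      rw [map_zero, h1, mul_smul_comm, smul_mul_assoc, hortho g hg, smul_zero]

/-- The crossed product is the corner of `ℚ G` at `e`, if `e` is orthogonal to its conjugates by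
elements that do not centralize it. -/
def crossedEquivCorner (hE : IsIdempotentElem (groupAlgebraIncl L e))
    (hortho : ∀ g ∉ cen L e, groupAlgebraIncl L e * of ℚ G g * groupAlgebraIncl L e = 0) :
    CrossedProduct (cenSystem he hc s hs) ≃+* hE.Corner :=
  equivCorner hE (crossedToGroupAlgebra he hc s hs) (crossedToGroupAlgebra_mul he hc s hs)
    (crossedToGroupAlgebra_injective he hc s hs) (crossedToGroupAlgebra_mem_corner he hc s hs)
    (exists_crossedToGroupAlgebra_eq he hc s hs hortho)

end CrossedProductCorner

end

noncomputable section

/-! ### The sum of the conjugates of an idempotent -/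

section ConjugateSum

open MonoidAlgebra

variable {G : Type*} [Group G] {e : ℚ[G]}

theorem of_mul_mul_of_inv_eq_iff {g : G} :
    of ℚ G g * e * of ℚ G g⁻¹ = e ↔ g ∈ centralizerOf e := by
  constructor
  · intro h
    show of ℚ G g * e = e * of ℚ G g
    conv_rhs => rw [← h, mul_assoc, of_inv_mul_of, mul_one]
  · intro h
    rw [show of ℚ G g * e = e * of ℚ G g from h, mul_assoc, of_mul_of_inv, mul_one]

variable (e) in
/-- The sum of the distinct conjugates of `e`. -/
def conjugateSum [Fintype (G ⧸ centralizerOf e)] : ℚ[G] :=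
  ∑ q : G ⧸ centralizerOf e, of ℚ G q.out * e * of ℚ G q.out⁻¹

theorem conjugateSum_comm [Fintype (G ⧸ centralizerOf e)] (w : ℚ[G]) :
    w * conjugateSum e = conjugateSum e * w := by
  refine commute_of_forall_of (fun g => ?_) w
  rw [conjugateSum, Finset.mul_sum, Finset.sum_mul]
  refine Fintype.sum_equiv (MulAction.toPerm g) _ _ fun q => ?_
  -- Left multiplication by g permutes the cosets but changes the chosen representative by some c ∈
  -- Cen_G(e), which does not affect the conjugate of e.
  obtain ⟨c, hc⟩ := QuotientGroup.mk_out_eq_mul (centralizerOf e) (g * q.out)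
  have h1 : (MulAction.toPerm g q : G ⧸ centralizerOf e).out = g * q.out * c := by
    rw [← hc]
    congr 1
    rw [MulAction.toPerm_apply]
    conv_lhs => rw [← QuotientGroup.out_eq' q]
    rfl
  have h2 := of_mul_mul_of_inv_eq_iff.2 c.2
  rw [h1]
  simp only [mul_inv_rev, map_mul]
  calc of ℚ G g * (of ℚ G q.out * e * of ℚ G q.out⁻¹)
      = of ℚ G g * of ℚ G q.out * (of ℚ G c * e * of ℚ G (c : G)⁻¹) * of ℚ G q.out⁻¹ *
          (of ℚ G g⁻¹ * of ℚ G g) := by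
        rw [h2, of_inv_mul_of, mul_one]
        simp only [mul_assoc]
    _ = _ := by simp only [mul_assoc]

variable (he : e * e = e) (hortho : ∀ g ∉ centralizerOf e, e * of ℚ G g * e = 0)

include he hortho in
-- These are the matrix unit relations: for p ≠ q the element `p.out⁻¹ * q.out` lies outside
-- Cen_G(e), so orthogonality applies.
theorem mul_of_out_mul [DecidableEq (G ⧸ centralizerOf e)] (p q : G ⧸ centralizerOf e) :
    e * of ℚ G p.out⁻¹ * (of ℚ G q.out * e) = if p = q then e else 0 := by
  rw [mul_assoc, ← mul_assoc (of ℚ G p.out⁻¹), ← map_mul, ← mul_assoc]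
  split_ifs with h
  · rw [h, inv_mul_cancel, map_one, mul_one, he]
  · refine hortho _ fun hmem => h ?_
    rw [← QuotientGroup.out_eq' p, ← QuotientGroup.out_eq' q]
    exact QuotientGroup.eq.2 hmem

include he in
theorem conjugateSum_eq [Fintype (G ⧸ centralizerOf e)] :
    conjugateSum e = ∑ q : G ⧸ centralizerOf e,
      of ℚ G q.out * e * (e * of ℚ G q.out⁻¹) := by
  refine Finset.sum_congr rfl fun q _ => ?_
  rw [mul_assoc, mul_assoc, ← mul_assoc e e, he]

include he hortho in
theorem conjugateSum_mul_of_out [Fintype (G ⧸ centralizerOf e)] (q : G ⧸ centralizerOf e) :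
    conjugateSum e * (of ℚ G q.out * e) = of ℚ G q.out * e := by
  classical
  rw [conjugateSum_eq he, Finset.sum_mul, Finset.sum_eq_single q]
  · rw [mul_assoc, mul_of_out_mul he hortho, if_pos rfl, mul_assoc, he]
  · intro p _ hp
    rw [mul_assoc, mul_of_out_mul he hortho, if_neg hp, mul_zero]
  · simp

include he hortho in
theorem conjugateSum_mul_self [Fintype (G ⧸ centralizerOf e)] :
    conjugateSum e * conjugateSum e = conjugateSum e := by
  conv_lhs => enter [2]; rw [conjugateSum]
  rw [Finset.mul_sum]
  refine Finset.sum_congr rfl fun q _ => ?_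
  rw [← mul_assoc, conjugateSum_mul_of_out he hortho]

include he hortho in
theorem conjugateSum_ne_zero [Fintype (G ⧸ centralizerOf e)] (h0 : e ≠ 0) :
    conjugateSum e ≠ 0 := by
  classical
  intro h
  have h1 := conjugateSum_mul_of_out he hortho (QuotientGroup.mk 1)
  have h2 := mul_of_out_mul he hortho (QuotientGroup.mk 1) (QuotientGroup.mk 1)
  rw [← h1, h, zero_mul, mul_zero, if_pos rfl] at h2
  exact h0 h2.symm

theorem conjugateSum_mul [Fintype (G ⧸ centralizerOf e)] {z : ℚ[G]} (hz : ∀ w, w * z = z * w)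
    (h : z * e = e) : conjugateSum e * z = conjugateSum e := by
  rw [conjugateSum, Finset.sum_mul]
  refine Finset.sum_congr rfl fun q _ => ?_
  rw [hz, ← mul_assoc, ← mul_assoc, ← hz, mul_assoc (of ℚ G q.out), h]

end ConjugateSum

/-! ### Shoda pairs, restriction to A, and orthogonality of conjugates -/

section Shoda

open MonoidAlgebra

variable {G : Type*} [Group G] {H K A L : Subgroup G} {ψ : H →* ℂˣ}

/-- If ψ(g⁻¹hg) = ψ(h) whenever both sides make sense, then every commutator [h, g] in H lies in ker
ψ = K, and the Shoda pair condition gives g ∈ H. -/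
theorem IsShodaPair.shodaCondition (hHK : IsShodaPair H K) (hψ : kernelIn ψ = K) :
    ShodaCondition ψ := by
  intro g hg
  by_contra! hcon
  refine hg (hHK.mem_of_commutator g fun h hh hc => ?_)
  have h1 : g⁻¹ * h * g ∈ H := by
    have := H.mul_mem hh hc
    simpa [mul_assoc] using this
  have h2 := hcon ⟨h, hh⟩ ⟨_, h1⟩ rfl
  rw [← hψ]
  refine ⟨⟨h, hh⟩⁻¹ * ⟨g⁻¹ * h * g, h1⟩, ?_, by simp [mul_assoc]⟩
  show ψ _ = 1
  rw [map_mul, map_inv, h2, inv_mul_cancel]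

/-- A linear character of `H` regarded as a character of `H` as a subgroup of `L`. -/
def linearOn (hHL : H ≤ L) (ψ : H →* ℂˣ) : H.subgroupOf L →* ℂˣ :=
  ψ.comp (Subgroup.subgroupOfEquivOfLe hHL).toMonoidHom

theorem ShodaCondition.linearOn (hψ : ShodaCondition ψ) (hHL : H ≤ L) :
    ShodaCondition (linearOn hHL ψ) := by
  intro g hg
  obtain ⟨h, h', h1, h2⟩ := hψ g hg
  refine ⟨⟨⟨h, hHL h.2⟩, h.2⟩, ⟨⟨h', hHL h'.2⟩, h'.2⟩, Subtype.ext h1, h2⟩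

theorem inducedIdempotent_mul_of [Fintype G] [Fintype H] {b : G} {c : ℂˣ}
    (h : ∀ x : G, ∃ a : H, (a : G) = x⁻¹ * b * x ∧ ψ a = c) :
    inducedIdempotent ψ * of ℂ G b = (c : ℂ) • inducedIdempotent ψ := by
  rw [inducedIdempotent, smul_mul_assoc, smul_comm, Finset.sum_mul, Finset.smul_sum (r := (c : ℂ))]
  congr 1
  refine Finset.sum_congr rfl fun x _ => ?_
  obtain ⟨a, ha, hc⟩ := h x
  have h1 : x⁻¹ * b = a * x⁻¹ := by rw [ha]; simp
  rw [mul_assoc, ← map_mul, h1, map_mul, ← mul_assoc, mul_assoc (of ℂ G x),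
    linearIdempotent_mul_of, hc, mul_smul_comm, smul_mul_assoc]

theorem mapDomain_linearIdempotent [Fintype H] (hHL : H ≤ L) [Fintype (H.subgroupOf L)] :
    mapDomainRingHom ℂ L.subtype (linearIdempotent (linearOn hHL ψ)) = linearIdempotent ψ := by
  have h1 : Nat.card (H.subgroupOf L) = Nat.card H :=
    Nat.card_congr (Subgroup.subgroupOfEquivOfLe hHL).toEquiv
  have h2 : ∀ (c : ℂ) (x : ℂ[L]), mapDomainRingHom ℂ L.subtype (c • x) =
      c • mapDomainRingHom ℂ L.subtype x := fun c x => mapDomain_smul _ _ _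
  rw [linearIdempotent, linearIdempotent, h2, map_sum, h1]
  congr 1
  refine Fintype.sum_equiv (Subgroup.subgroupOfEquivOfLe hHL).toEquiv _ _ fun x => ?_
  rw [mapDomainRingHom_apply, mapDomain_single]
  rfl

/-- The idempotent of ψ^G is central and absorbs ε, hence absorbs all L-conjugates of ε. This
reflects ψ^G = (ψ^L)^G. -/
theorem mapDomain_inducedIdempotent_mul [Fintype G] [Fintype H] [Fintype L] (hHL : H ≤ L)
    [Fintype (H.subgroupOf L)] (hψ : ShodaCondition ψ) :
    mapDomainRingHom ℂ L.subtype (inducedIdempotent (linearOn hHL ψ)) * inducedIdempotent ψ =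
      mapDomainRingHom ℂ L.subtype (inducedIdempotent (linearOn hHL ψ)) := by
  have h2 : ∀ (c : ℂ) (x : ℂ[L]), mapDomainRingHom ℂ L.subtype (c • x) =
      c • mapDomainRingHom ℂ L.subtype x := fun c x => mapDomain_smul _ _ _
  rw [inducedIdempotent, h2, map_sum, smul_mul_assoc, Finset.sum_mul]
  congr 1
  refine Finset.sum_congr rfl fun x _ => ?_
  rw [map_mul, map_mul, mapDomain_linearIdempotent, mul_assoc, inducedIdempotent_comm, ← mul_assoc,
    mul_assoc (mapDomainRingHom ℂ L.subtype (of ℂ L x)), linearIdempotent_mul_inducedIdempotent hψ]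

theorem rationalInducedIdempotent_mul_incl [Fintype G] [Fintype H] [Fintype L] (hHL : H ≤ L)
    [Fintype (H.subgroupOf L)] (hψ : ShodaCondition ψ) :
    rationalInducedIdempotent ψ *
        groupAlgebraIncl L (rationalInducedIdempotent (linearOn hHL ψ)) =
      groupAlgebraIncl L (rationalInducedIdempotent (linearOn hHL ψ)) := by
  have := mul_rationalInducedIdempotent_eq_mul (linearOn hHL ψ) L.subtype
    (rationalInducedIdempotent ψ) 1 ?_
  · rwa [one_mul] at this
  · rw [map_one, one_mul, ← mapDomain_inducedIdempotent_mul hHL hψ, inducedIdempotent_comm,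
      ← mul_assoc, rationalInducedIdempotent_mul_inducedIdempotent hψ]

section Restriction

variable [Fintype L] (hA : A.Normal) (hAH : A ≤ H) (hHL : H ≤ L)
  [Fintype (H.subgroupOf L)]
  (hinv : ∀ x ∈ L, ∀ a : A,
    restrictTo hAH ψ ⟨x * a * x⁻¹, hA.conj_mem a a.2 x⟩ = restrictTo hAH ψ a)

include hinv in
-- By L-invariance of ψ_A, all L-conjugates of a have the same value under ψ, so a acts on every
-- L-conjugate of ε by that one scalar.
theorem of_mul_mapDomain_inducedIdempotent (a : A) :
    of ℂ G a * mapDomainRingHom ℂ L.subtype (inducedIdempotent (linearOn hHL ψ)) =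
      (restrictTo hAH ψ a : ℂ) •
        mapDomainRingHom ℂ L.subtype (inducedIdempotent (linearOn hHL ψ)) := by
  have h1 : inducedIdempotent (linearOn hHL ψ) * of ℂ L ⟨a, hHL (hAH a.2)⟩ =
      (restrictTo hAH ψ a : ℂ) • inducedIdempotent (linearOn hHL ψ) := by
    refine inducedIdempotent_mul_of fun x => ?_
    have h2 : (x : G)⁻¹ * a * x ∈ A := by
      simpa using hA.conj_mem a a.2 (x : G)⁻¹
    refine ⟨⟨⟨(x : G)⁻¹ * a * x, hHL (hAH h2)⟩, hAH h2⟩, rfl, ?_⟩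
    rw [← hinv (x : G)⁻¹ (L.inv_mem x.2) a]
    simp only [inv_inv]
    rfl
  rw [← inducedIdempotent_comm] at h1
  have h2 := congrArg (mapDomainRingHom ℂ L.subtype) h1
  rw [map_mul] at h2
  have h3 : mapDomainRingHom ℂ L.subtype (of ℂ L ⟨a, hHL (hAH a.2)⟩) = of ℂ G a := by
    simp [of_apply]
  rw [h3] at h2
  exact h2.trans (mapDomain_smul _ _ _)

include hinv in
theorem of_mul_incl_rationalInducedIdempotent {a : A} (ha : restrictTo hAH ψ a = 1) :
    of ℚ G a * groupAlgebraIncl L (rationalInducedIdempotent (linearOn hHL ψ)) =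
      groupAlgebraIncl L (rationalInducedIdempotent (linearOn hHL ψ)) := by
  have := mul_rationalInducedIdempotent_eq_mul (linearOn hHL ψ) L.subtype (of ℚ G a) 1 ?_
  · rwa [one_mul] at this
  · have h1 := of_mul_mapDomain_inducedIdempotent hA hAH hHL hinv a
    rw [ha, Units.val_one, one_smul] at h1
    have h2 : mapRingHom G (algebraMap ℚ ℂ) (of ℚ G a) = of ℂ G a := by simp [of_apply]
    rw [h2, h1, map_one, one_mul]

include hinv in
-- On the complex idempotent E of ψ^L, b acts by ψ(b), while zb = z; thus zE = ψ(b)zE with ψ(b) ≠ 1,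
-- so zE = 0, and this descends to ℚ.
theorem mul_incl_rationalInducedIdempotent_eq_zero {b : A} (hb : restrictTo hAH ψ b ≠ 1)
    {z : ℚ[G]} (hz : z * of ℚ G b = z) :
    z * groupAlgebraIncl L (rationalInducedIdempotent (linearOn hHL ψ)) = 0 := by
  have := mul_rationalInducedIdempotent_eq_mul (linearOn hHL ψ) L.subtype z 0 ?_
  · rwa [zero_mul] at this
  · have h1 := of_mul_mapDomain_inducedIdempotent hA hAH hHL hinv b
    set E := mapDomainRingHom ℂ L.subtype (inducedIdempotent (linearOn hHL ψ))
    set y := mapRingHom G (algebraMap ℚ ℂ) z with hy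
    have h2 : y * of ℂ G b = y := by
      have := congrArg (mapRingHom G (algebraMap ℚ ℂ)) hz
      simpa [of_apply] using this
    have h3 : y * E = (restrictTo hAH ψ b : ℂ) • (y * E) := by
      conv_lhs => rw [← h2, mul_assoc, h1, mul_smul_comm]
    have h4 : ((restrictTo hAH ψ b : ℂ) - 1) • (y * E) = 0 := by
      rw [sub_smul, one_smul, ← h3, sub_self]
    rw [map_zero, zero_mul]
    refine (smul_eq_zero.1 h4).resolve_left fun h5 => hb (Units.ext ?_)
    rw [sub_eq_zero.1 h5, Units.val_one]

include hinv in
/-- If the conjugate of the idempotent by `g` is not orthogonal to it, then `g` normalizes the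
kernel of the restriction to `A`. -/
theorem mem_normalizer_of_conj_mul_ne_zero [Finite G] {g : G}
    (hg : of ℚ G g * groupAlgebraIncl L (rationalInducedIdempotent (linearOn hHL ψ)) * of ℚ G g⁻¹ *
      groupAlgebraIncl L (rationalInducedIdempotent (linearOn hHL ψ)) ≠ 0) :
    g ∈ Subgroup.normalizer (kernelIn (restrictTo hAH ψ) : Set G) := by
  have := Fintype.ofFinite G
  -- As G is finite, it suffices that g conjugates the kernel into itself.
  refine Subgroup.mem_normalizer_fintype fun n hn => ?_
  obtain ⟨a, ha, rfl⟩ := hn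
  by_contra hcon
  -- Here z = geg⁻¹ and b = gag⁻¹ ∈ A: since a fixes e, b fixes z on the right, while ψ(b) ≠ 1 by
  -- assumption.
  refine hg (mul_incl_rationalInducedIdempotent_eq_zero hA hAH hHL hinv
    (b := ⟨g * a * g⁻¹, hA.conj_mem a a.2 g⟩) (fun h => hcon ⟨_, h, rfl⟩) ?_)
  set e := groupAlgebraIncl L (rationalInducedIdempotent (linearOn hHL ψ)) with he
  have h1 : of ℚ G a * e = e := of_mul_incl_rationalInducedIdempotent hA hAH hHL hinv ha
  have h2 : e * of ℚ G a = e := by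
    conv_rhs => rw [← h1]
    rw [show of ℚ G a = groupAlgebraIncl L (of ℚ L ⟨a, hHL (hAH a.2)⟩) from
      (groupAlgebraIncl_of (L := L) ⟨a, hHL (hAH a.2)⟩).symm, he, ← map_mul, ← map_mul,
      rationalInducedIdempotent_comm]
  rw [map_mul, map_mul, mul_assoc (of ℚ G g * e), mul_assoc (of ℚ G g), ← mul_assoc (of ℚ G g⁻¹),
    ← mul_assoc (of ℚ G g⁻¹), of_inv_mul_of, one_mul, mul_assoc (of ℚ G g), ← mul_assoc e, h2]

end Restriction

/-- A central idempotent of `ℚ L` that is primitive among central idempotents either equals or is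
orthogonal to its conjugate by an element normalizing `L`. -/
theorem mem_cen_of_conj_mul_ne_zero {N : Subgroup G} (hLN : L ≤ N) [(L.subgroupOf N).Normal]
    {e : ℚ[L]} (hi : e * e = e) (hc : ∀ w, w * e = e * w)
    (hprim : ∀ z : ℚ[L], (∀ w, w * z = z * w) → z * z = z → z * e = 0 ∨ z * e = e) (g : N)
    (hg : of ℚ G g * groupAlgebraIncl L e * of ℚ G (g : G)⁻¹ * groupAlgebraIncl L e ≠ 0) :
    (g : G) ∈ cen L e := by
  have hconj : ∀ g : N, groupAlgebraIncl L (conjAlg hLN g e) =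
      of ℚ G g * groupAlgebraIncl L e * of ℚ G (g : G)⁻¹ := by
    intro g
    rw [← incl_conjAlg_mul hLN, mul_assoc, of_mul_of_inv, mul_one]
  have hcases : ∀ g : N, conjAlg hLN g e * e = 0 ∨ conjAlg hLN g e * e = e := by
    intro g
    refine hprim _ (fun w => ?_) (by rw [← map_mul, hi])
    obtain ⟨v, rfl⟩ := (conjAlg hLN g).surjective w
    rw [← map_mul, ← map_mul, hc]
  have h1 : conjAlg hLN g e * e = e := by
    refine (hcases g).resolve_left fun h => hg ?_
    rw [← hconj, ← map_mul, h, map_zero]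
  rw [← of_mul_mul_of_inv_eq_iff]
  have h2 : groupAlgebraIncl L e * (of ℚ G g * groupAlgebraIncl L e * of ℚ G (g : G)⁻¹) =
      groupAlgebraIncl L e := by rw [← hconj, ← map_mul, ← hc, h1]
  have h3 : ∀ w : ℚ[G], of ℚ G g * (of ℚ G (g : G)⁻¹ * w) = w := fun w => by
    rw [← mul_assoc, of_mul_of_inv, one_mul]
  -- So far geg⁻¹ only absorbs e. Conjugating by g turns g⁻¹eg·e into e·geg⁻¹ = e, so the dichotomy
  -- for g⁻¹ yields equality.
  have h4 : of ℚ G g * groupAlgebraIncl L (conjAlg hLN g⁻¹ e * e) * of ℚ G (g : G)⁻¹ =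
      groupAlgebraIncl L e := by
    rw [map_mul, hconj]
    simp only [InvMemClass.coe_inv, inv_inv, mul_assoc, h3]
    simp only [mul_assoc] at h2
    exact h2
  rcases hcases g⁻¹ with h5 | h5
  · rw [h5, map_zero, mul_zero, zero_mul] at h4
    rw [← h4]
    simp
  · rwa [h5] at h4

end Shoda

end

/-! ### Assembling the isomorphism -/

theorem isMulCentral_of_comm {M : Type*} [Semigroup M] {z : M} (h : ∀ w, w * z = z * w) :
    IsMulCentral z where
  comm w := (h w).symm
  left_assoc b c := (mul_assoc z b c).symm
  right_assoc a b := mul_assoc a b z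

theorem subgroupOf_normal_of_le {G : Type*} [Group G] {L C N : Subgroup G} (hCN : C ≤ N)
    (h : (L.subgroupOf N).Normal) : (L.subgroupOf C).Normal :=
  ⟨fun n hn g => h.conj_mem ⟨n, hCN n.2⟩ hn ⟨g, hCN g.2⟩⟩

theorem proposition6p1 {G : Type*} [Group G] [Finite G] (H K A L : Subgroup G)
    (hHK : IsShodaPair H K)
    (ψ : H →* ℂˣ) (hψ : kernelIn ψ = K)
    (hA : A.Normal) (hAH : A ≤ H) (hHL : H ≤ L)
    (hinv : ∀ x ∈ L, ∀ a : A,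
      restrictTo hAH ψ ⟨x * a * x⁻¹, hA.conj_mem a a.2 x⟩ = restrictTo hAH ψ a)
    (hLN : L ≤ Subgroup.normalizer (kernelIn (restrictTo hAH ψ) : Set G))
    (hLnormal :
      (L.subgroupOf (Subgroup.normalizer (kernelIn (restrictTo hAH ψ) : Set G))).Normal) :
    ∃ (eG : ℚ[G]) (eL : ℚ[L]),
      IsRationalIdempotent (inducedCharacter H (linearCharacter ψ)) eG ∧
      IsRationalIdempotent (inducedTo hHL ψ) eL ∧
      IsMulCentral eG ∧
      ∃ (hG : IsIdempotentElem eG) (hL : IsIdempotentElem eL) (hLc : IsMulCentral eL)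
        (_ : (L.subgroupOf (cen L eL)).Normal),
        ∀ (s : cen L eL ⧸ L.subgroupOf (cen L eL) → cen L eL)
          (hs : ∀ q, (s q : cen L eL ⧸ L.subgroupOf (cen L eL)) = q),
          Nonempty (hG.Corner ≃+*
            Matrix (Fin (cen L eL).index) (Fin (cen L eL).index)
              (CrossedProduct (cenSystem hL hLc s hs))) := by
  classical
  have := Fintype.ofFinite G
  have := Fintype.ofFinite H
  have := Fintype.ofFinite L
  have := Fintype.ofFinite (H.subgroupOf L)
  have hS := hHK.shodaCondition hψ
  have hSL := hS.linearOn hHL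
  set eL := rationalInducedIdempotent (linearOn hHL ψ) with heL
  have hLi : eL * eL = eL := rationalInducedIdempotent_mul_self hSL
  have hLcomm : ∀ w, w * eL = eL * w := rationalInducedIdempotent_comm _
  set E := groupAlgebraIncl L eL with hEdef
  have hEi : E * E = E := by rw [hEdef, ← map_mul, hLi]
  have hE0 : E ≠ 0 := fun h => rationalInducedIdempotent_ne_zero hSL
    (incl_injective L (h.trans (map_zero (groupAlgebraIncl L)).symm))
  have hconjN : ∀ g : G, MonoidAlgebra.of ℚ G g * E * MonoidAlgebra.of ℚ G g⁻¹ * E ≠ 0 →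
      g ∈ Subgroup.normalizer (kernelIn (restrictTo hAH ψ) : Set G) := fun g hg =>
    mem_normalizer_of_conj_mul_ne_zero hA hAH hHL hinv hg
  have hCN : cen L eL ≤ Subgroup.normalizer (kernelIn (restrictTo hAH ψ) : Set G) := by
    intro g hg
    refine hconjN g ?_
    rw [of_mul_mul_of_inv_eq_iff.2 hg, hEi]
    exact hE0
  have hortho : ∀ g ∉ cen L eL, E * MonoidAlgebra.of ℚ G g * E = 0 := by
    intro g hg
    -- The inverse appears because EgE = g·(g⁻¹Eg)·E.
    have h1 : MonoidAlgebra.of ℚ G g⁻¹ * E * MonoidAlgebra.of ℚ G g⁻¹⁻¹ * E = 0 := by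
      by_contra hne
      refine hg ((Subgroup.inv_mem_iff _).1 (mem_cen_of_conj_mul_ne_zero hLN hLi hLcomm
        (fun z => mul_rationalInducedIdempotent_eq_zero_or hSL) ⟨g⁻¹, hconjN _ hne⟩ hne))
    have h2 := congrArg (MonoidAlgebra.of ℚ G g * ·) h1
    simpa only [inv_inv, mul_zero, ← mul_assoc, of_mul_of_inv, one_mul] using h2
  have := Fintype.ofFinite (G ⧸ cen L eL)
  have hsum : conjugateSum E = rationalInducedIdempotent ψ := by
    have h1 : conjugateSum E * rationalInducedIdempotent ψ = conjugateSum E :=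
      conjugateSum_mul (rationalInducedIdempotent_comm ψ)
        (rationalInducedIdempotent_mul_incl hHL hS)
    -- The sum of conjugates is central, idempotent and nonzero, and lies under e_ℚ(ψ^G);
    -- primitivity leaves only equality.
    rcases mul_rationalInducedIdempotent_eq_zero_or hS (conjugateSum_comm (e := E))
      (conjugateSum_mul_self hEi hortho) with h2 | h2
    · exact absurd (h1.symm.trans h2) (conjugateSum_ne_zero hEi hortho hE0)
    · exact h1.symm.trans h2
  have hEI : IsIdempotentElem E := hEi
  have hLI : IsIdempotentElem eL := hLi
  have hLc : IsMulCentral eL := isMulCentral_of_comm hLcomm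
  have hG : IsIdempotentElem (rationalInducedIdempotent ψ) := rationalInducedIdempotent_mul_self hS
  have hnorm : (L.subgroupOf (cen L eL)).Normal := subgroupOf_normal_of_le hCN hLnormal
  refine ⟨rationalInducedIdempotent ψ, eL, isRationalIdempotent_rationalInducedIdempotent ψ,
    isRationalIdempotent_rationalInducedIdempotent (linearOn hHL ψ),
    isMulCentral_of_comm (rationalInducedIdempotent_comm ψ), hG, hLI, hLc, hnorm,
    fun s hs => ⟨?_⟩⟩
  -- The index is by definition the cardinality of G/C, so the cosets can be numbered to give the
  -- size of the matrices.
  let r : Fin (cen L eL).index ≃ G ⧸ cen L eL := (Finite.equivFinOfCardEq rfl).symm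
  refine (cornerEquivMatrix (ι := Fin (cen L eL).index) (e := E) hEI hG
    (fun i => MonoidAlgebra.of ℚ G (r i).out * E) (fun i => E * MonoidAlgebra.of ℚ G (r i).out⁻¹)
    (fun i => by rw [mul_assoc, hEi]) (fun i => by rw [← mul_assoc, hEi])
    (fun i j => ?_) ?_).trans (crossedEquivCorner hLI hLc s hs hEI hortho).symm.mapMatrix
  · rw [mul_of_out_mul hEi hortho]
    simp only [r.injective.eq_iff]
  · rw [← hsum, conjugateSum_eq hEi]
    exact r.sum_comp fun q => MonoidAlgebra.of ℚ G q.out * E * (E * MonoidAlgebra.of ℚ G q.out⁻¹)
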